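/- Fix a dimension $d$, a range $r\in\mathbb N$ and constants $0<a\le b$. Consider a box $\Lambda$ of the $d$-dimensional hypercubic lattice with $N$ sites, all side lengths greater than $r$, and free or periodic boundary conditions, with one qubit per site. Let $H=\sum_P c_PP$ be a Hamiltonian expanded in the Pauli operators on the $N$ qubits with real coefficients, $c_I=0$, that is local and extensive: (i) $c_P=0$ if the diameter of the support of $P$ (in the maximum metric) is greater than $r$; (ii) for every hypercubic region $R=\prod_k[u_k,u_k+r]$ of $\Lambda$ there is a $P$ with $c_P\ne0$ and $\operatorname{supp}P\subseteq R$; (iii) $a\le|c_P|\le b$ whenever $c_P\neq0$. Let $E(\beta)=\operatorname{tr}(He^{-\beta H})/\operatorname{tr}(e^{-\beta H})$, and let $S=\{|x^\pm\rangle,|y^\pm\rangle,|z^\pm\rangle\}^{\otimes N}$ be the set of products of eigenvectors of the Pauli matrices. For an orthonormal eigenbasis $\{|j\rangle\}$ of $H$ let $1/D^{\mathrm{eff}}_\psi=\sum_j|\langle j|\psi\rangle|^4$. For a window $\delta(N)=o(N)$ let $\mathcal E^{\mathrm{mc}}_\beta$ be the uniform distribution over $S_\beta=\{|\psi\rangle\in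 S:\ |\langle\psi|H|\psi\rangle-E(\beta)|\le\delta(N)\}$. There are constants $C,K,\gamma>0$, depending only on $d,r,a,b$, such that for every window with $\delta(N)=o(N)$ and $\delta(N)\ge K$ for all large $N$ there is an $N_0$ such that for all such $\Lambda$ with $N\ge N_0$ sites, all such $H$, every orthonormal eigenbasis of $H$ and all $\beta$ with $|\beta|\le C$, the set $S_\beta$ is non-empty and $$\mathop{\mathbb E}_{|\psi\rangle\sim\mathcal E^{\mathrm{mc}}_\beta}\frac1{D^{\mathrm{eff}}_\psi}\le e^{-\gamma N},\qquad \Pr_{|\psi\rangle\sim\mathcal E^{\mathrm{mc}}_\beta}\big(D^{\mathrm{eff}}_\psi\ge e^{\gamma N}\big)\ge1-e^{-\gamma N}.$$ -/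

import Mathlib

open Filter Asymptotics

namespace QubitLattice

noncomputable section

/-! ### Qubits, Pauli operators, product states -/

/-- The three directions of the Pauli matrices. -/
inductive Axis
  | x
  | y
  | z
  deriving DecidableEq

instance : Fintype Axis where
  elems := {Axis.x, Axis.y, Axis.z}
  complete := fun k => by cases k <;> decide

/-- The Pauli matrices `σˣ`, `σʸ`, `σᶻ`. -/
def sigma : Axis → Matrix (Fin 2) (Fin 2) ℂ
  | .x => !![0, 1; 1, 0]
  | .y => !![0, -Complex.I; Complex.I, 0]
  | .z => !![1, 0; 0, -1]

/-- The operators `I, σˣ, σʸ, σᶻ` of one qubit; `none` stands for the identity. -/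
def sigma' : Option Axis → Matrix (Fin 2) (Fin 2) ℂ
  | none => 1
  | some k => sigma k

/-- The sign `±1` encoded by a Boolean (`true` is `+1`). -/
def sgn (s : Bool) : ℂ := if s then 1 else -1

/-- The normalized eigenvector of `σᵏ` with eigenvalue `sgn s`:
the six vectors `|x^±⟩, |y^±⟩, |z^±⟩`. -/
def qubitState : Axis × Bool → Fin 2 → ℂ
  | (.x, s) => ![1 / (Real.sqrt 2 : ℂ), sgn s / (Real.sqrt 2 : ℂ)]
  | (.y, s) => ![1 / (Real.sqrt 2 : ℂ), sgn s * Complex.I / (Real.sqrt 2 : ℂ)]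
  | (.z, s) => if s then ![1, 0] else ![0, 1]

/-- The Hilbert space `(ℂ²)^{⊗Λ}` of qubits at the sites of `Λ`, in the computational basis. -/
abbrev Hilb (Λ : Type) [Fintype Λ] : Type := EuclideanSpace ℂ (Λ → Fin 2)

/-- Operators on the qubits at the sites of `Λ`, as matrices in the computational basis. -/
abbrev Op (Λ : Type) : Type := Matrix (Λ → Fin 2) (Λ → Fin 2) ℂ

/-- Labels of the Pauli operators on the qubits of `Λ`. -/
abbrev PauliString (Λ : Type) : Type := Λ → Option Axis

/-- Labels of the `6^N` product states `{|x^±⟩, |y^±⟩, |z^±⟩}^{⊗N}`. -/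
abbrev ProductLabel (Λ : Type) : Type := Λ → Axis × Bool

section Qubits

variable {Λ : Type} [Fintype Λ] [DecidableEq Λ]

/-- The Pauli operator `⊗ᵢ σ^{P i}`. -/
def pauliOp (P : PauliString Λ) : Op Λ :=
  Matrix.of fun s t => ∏ i, sigma' (P i) (s i) (t i)

/-- The set of qubits on which a Pauli operator acts non-trivially. -/
def supp (P : PauliString Λ) : Finset Λ := Finset.univ.filter fun i => P i ≠ none

/-- The Hamiltonian `∑_P c_P P`. -/
def hamiltonian (c : PauliString Λ → ℝ) : Op Λ := ∑ P, (c P : ℂ) • pauliOp P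

/-- The product state `⊗ᵢ |ψ i⟩`. -/
def productState (ψ : ProductLabel Λ) : Hilb Λ :=
  WithLp.toLp 2 fun s => ∏ i, qubitState (ψ i) (s i)

/-- The energy `⟨v|H|v⟩`. -/
def energy (H : Op Λ) (v : Hilb Λ) : ℝ :=
  (inner ℂ v (Matrix.toEuclideanLin H v)).re

/-- The thermal state `e^{-βH} / tr e^{-βH}`. -/
def gibbs (H : Op Λ) (β : ℝ) : Op Λ :=
  (Matrix.trace (NormedSpace.exp (-(β : ℂ) • H)))⁻¹ • NormedSpace.exp (-(β : ℂ) • H)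

/-- The thermal energy `E(β) = tr (ρ_β H)`. -/
def thermalEnergy (H : Op Λ) (β : ℝ) : ℝ := (Matrix.trace (gibbs H β * H)).re

/-- The orthonormal basis `e` consists of eigenvectors of `H`. -/
def IsEigenbasis {J : Type} [Fintype J] (H : Op Λ) (e : OrthonormalBasis J ℂ (Hilb Λ)) : Prop :=
  ∀ j, ∃ ε : ℝ, Matrix.toEuclideanLin H (e j) = (ε : ℂ) • e j

/-- The effective dimension of `v` with respect to the basis `e`:
`1 / D = ∑ⱼ |⟨j|v⟩|⁴`. -/
def effDim {J : Type} [Fintype J] (e : OrthonormalBasis J ℂ (Hilb Λ)) (v : Hilb Λ) : ℝ :=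
  (∑ j, ‖(inner ℂ (e j) v : ℂ)‖ ^ 4)⁻¹

open scoped Classical in
/-- The product states whose energy is within `δ` of the thermal energy `E(β)`. -/
def shell (H : Op Λ) (β δ : ℝ) : Finset (ProductLabel Λ) :=
  Finset.univ.filter fun ψ => |energy H (productState ψ) - thermalEnergy H β| ≤ δ

end Qubits

/-- Expectation of `f` under the uniform distribution on the finite set `S`. -/
def unifExp {α : Type} (S : Finset α) (f : α → ℝ) : ℝ := (∑ a ∈ S, f a) / (S.card : ℝ)

open scoped Classical in
/-- Probability of `p` under the uniform distribution on the finite set `S`. -/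
def unifProb {α : Type} (S : Finset α) (p : α → Prop) : ℝ :=
  ((S.filter p).card : ℝ) / (S.card : ℝ)

/-! ### Finite hypercubic lattices -/

/-- Boundary conditions of a finite lattice. -/
inductive Boundary
  | free
  | periodic

/-- Distance of two coordinates in a side of `ℓ` sites. -/
def coordDist (bc : Boundary) (ℓ : ℕ) (p q : Fin ℓ) : ℕ :=
  match bc with
  | .free => Nat.dist p q
  | .periodic => min (Nat.dist p q) (ℓ - Nat.dist p q)

/-- The sites of the finite `d`-dimensional hypercubic lattice with side lengths `L`. -/
abbrev Site {d : ℕ} (L : Fin d → ℕ) : Type := (k : Fin d) → Fin (L k)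

/-- Distance of two sites (maximum of the coordinate distances). -/
def siteDist (bc : Boundary) {d : ℕ} {L : Fin d → ℕ} (u v : Site L) : ℕ :=
  Finset.univ.sup fun k => coordDist bc (L k) (u k) (v k)

/-- The coefficients `c` define a local and extensive Hamiltonian without identity component, with
range `r` and with bounds `a ≤ |c_P| ≤ b` on the nonzero coefficients. A hypercubic region of side
length `r` is the set of sites `v` with `u k ≤ v k ≤ u k + r` in each direction `k`, where `u + r`
still lies in the box (so that, for periodic boundary conditions, nothing is asked of the regions
that wrap around). -/
structure IsLocalExtensive (bc : Boundary) {d : ℕ} {L : Fin d → ℕ} (r : ℕ) (a b : ℝ)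
    (c : PauliString (Site L) → ℝ) : Prop where
  traceless : c (fun _ => none) = 0
  isLocal : ∀ P, c P ≠ 0 → ∀ u ∈ supp P, ∀ v ∈ supp P, siteDist bc u v ≤ r
  isExtensive : ∀ u : Site L, (∀ k, (u k : ℕ) + r < L k) →
    ∃ P, c P ≠ 0 ∧ ∀ v ∈ supp P, ∀ k, (u k : ℕ) ≤ v k ∧ (v k : ℕ) ≤ u k + r
  bounded : ∀ P, c P ≠ 0 → a ≤ |c P| ∧ |c P| ≤ b

end

end QubitLattice

open QubitLattice

/-! Over all `6 ^ N` product states the mean of `1 / effDim` is at most `(2/3) ^ N`, for any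
orthonormal basis. For one qubit the six states satisfy a fourth-moment bound, which tensorizes to
`∑ ψ, |⟨v|ψ⟩|⁴ ≤ 2 ^ N` for unit `v`; summing over the `2 ^ N` basis vectors gives `4 ^ N`
(`sum_one_div_effDim_le`). Hence it suffices that the shell holds a fraction of the product states
exceeding `(2/3) ^ N` by an exponential factor; Markov's inequality then turns the mean into a
probability.

The shell is large because many product states lie on each side of it. Changing one qubit moves the
energy by at most `2 b D`, so a path from a state above `E(β)` to one below it meets the shell, and
counting end points gives `#above * #below ≤ N * #shell * 6 ^ N` (`card_mul_card_le_card_shell`).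

To get states on both sides, choose a small positive density of terms such that no term of `H`
touches two of them. Their supports can be fixed so that the mean energy over the other sites is
extensive, of either sign (`IsSparse.exists_energyInside_ge`). Averaging over the free sites yields
many such states, at the price of a factor 6 per fixed site (`IsSparse.card_productEnergy_ge`).

Finally `E(β)` must lie between these levels. At small `|β|` the Gibbs variational inequality,
tested on a commuting family of disjoint Pauli operators, makes the thermal energy density as small
as needed (`IsSparse.abs_thermalEnergy_le`). -/

namespace QubitLattice

/-! ### One qubit: Pauli expectations in the six eigenstates. -/

/-- The expectation value of `σ'` in the states `|x^±⟩, |y^±⟩, |z^±⟩` of one qubit. -/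
def siteChar : Option Axis → Axis × Bool → ℝ
  | none, _ => 1
  | some k, a => if k = a.1 then (if a.2 then 1 else -1) else 0

lemma ofReal_sqrt_two_mul_self : (Real.sqrt 2 : ℂ) * (Real.sqrt 2 : ℂ) = 2 := by
  rw [← Complex.ofReal_mul, Real.mul_self_sqrt (by norm_num)]; norm_num

lemma inv_ofReal_sqrt_two_sq : ((Real.sqrt 2 : ℂ)⁻¹) ^ 2 = 1 / 2 := by
  rw [inv_pow, sq, ofReal_sqrt_two_mul_self]; norm_num

lemma qubit_expectation (o : Option Axis) (a : Axis × Bool) :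
    ∑ s, ∑ t, star (qubitState a s) * sigma' o s t * qubitState a t = (siteChar o a : ℂ) := by
  have h := inv_ofReal_sqrt_two_sq
  obtain ⟨k, b⟩ := a
  rcases o with _ | o
  · cases k <;> cases b <;>
      simp [qubitState, sigma', siteChar, sgn, div_eq_mul_inv] <;> ring_nf <;>
      simp [h, ← two_mul]
  · cases o <;> cases k <;> cases b <;>
      simp [qubitState, sigma', sigma, siteChar, sgn, div_eq_mul_inv] <;> ring_nf <;>
      simp [h]

lemma sigma'_eigen (o : Option Axis) (k : Axis) (b : Bool) (h : o = none ∨ o = some k)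
    (s : Fin 2) :
    ∑ t, sigma' o s t * qubitState (k, b) t = (siteChar o (k, b) : ℂ) * qubitState (k, b) s := by
  rcases h with rfl | rfl
  · simp [sigma', siteChar, Matrix.one_apply]
  · cases k <;> cases b <;> fin_cases s <;>
      simp [qubitState, sigma', sigma, siteChar, sgn, div_eq_mul_inv] <;> ring_nf <;>
      simp

lemma qubitState_orthonormal (k : Axis) (b b' : Bool) :
    ∑ s, star (qubitState (k, b) s) * qubitState (k, b') s = if b = b' then 1 else 0 := by
  have h := inv_ofReal_sqrt_two_sq
  cases k <;> cases b <;> cases b' <;>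
      simp [qubitState, sgn, div_eq_mul_inv] <;> ring_nf <;>
      simp [h] <;> norm_num

lemma sum_axis {A : Type*} [AddCommMonoid A] (g : Axis → A) :
    ∑ k, g k = g .x + g .y + g .z := by
  simp [Finset.sum, Finset.univ, Fintype.elems, add_assoc]

lemma card_axis : Fintype.card Axis = 3 := rfl

lemma sum_siteChar (o : Option Axis) : ∑ a, siteChar o a = if o = none then 6 else 0 := by
  rcases o with _ | o
  · simp [siteChar, card_axis]
  · rw [Fintype.sum_prod_type]; cases o <;> simp [siteChar]

/-- Pauli expectations are orthogonal functions on the six states. The mean square `2 / 6` of a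
nontrivial one is the source of every factor `1 / 3` below. -/
lemma sum_siteChar_mul (o o' : Option Axis) :
    ∑ a, siteChar o a * siteChar o' a = if o = o' then (if o = none then 6 else 2) else 0 := by
  rcases o with _ | o <;> rcases o' with _ | o'
  · simp [siteChar, card_axis]
  · simpa [siteChar] using sum_siteChar (some o')
  · simpa [siteChar] using sum_siteChar (some o)
  · rw [Fintype.sum_prod_type]
    by_cases h : o = o'
    · subst h
      rw [sum_axis]
      cases o <;> simp [siteChar] <;> norm_num
    · simp only [siteChar, Option.some.injEq, if_neg h]
      refine Finset.sum_eq_zero fun k _ => Finset.sum_eq_zero fun b _ => ?_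
      by_cases h1 : o = k
      · rw [if_neg (fun h2 : o' = k => h (h1.trans h2.symm)), mul_zero]
      · rw [if_neg h1, zero_mul]

lemma abs_siteChar_le (o : Option Axis) (a : Axis × Bool) : |siteChar o a| ≤ 1 := by
  rcases o with _ | o
  · simp [siteChar]
  · simp only [siteChar]; split_ifs <;> simp

/-! ### Pauli strings and product states on many qubits. -/

section
variable {Λ : Type} [Fintype Λ]

/-- The expectation value of a Pauli operator in a product state. -/
noncomputable def pauliChar (P : PauliString Λ) (ψ : ProductLabel Λ) : ℝ :=
  ∏ i, siteChar (P i) (ψ i)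

lemma abs_pauliChar_le (P : PauliString Λ) (ψ : ProductLabel Λ) : |pauliChar P ψ| ≤ 1 := by
  rw [pauliChar, Finset.abs_prod]
  exact Finset.prod_le_one (fun _ _ => abs_nonneg _) fun _ _ => abs_siteChar_le _ _

lemma mem_supp {P : PauliString Λ} {i : Λ} : i ∈ supp P ↔ P i ≠ none := by simp [supp]

variable [DecidableEq Λ]

lemma pauliOp_toEuclideanLin_apply (P : PauliString Λ) (v : Hilb Λ) (s : Λ → Fin 2) :
    Matrix.toEuclideanLin (pauliOp P) v s = ∑ t, (∏ i, sigma' (P i) (s i) (t i)) * v t := by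
  simp [Matrix.toLpLin_apply, Matrix.mulVec, dotProduct, pauliOp]

lemma inner_pauliOp_productState (P : PauliString Λ) (ψ : ProductLabel Λ) :
    inner ℂ (productState ψ) (Matrix.toEuclideanLin (pauliOp P) (productState ψ))
      = (pauliChar P ψ : ℂ) := by
  rw [PiLp.inner_apply, pauliChar, Complex.ofReal_prod]
  simp only [← qubit_expectation]
  simp_rw [Fintype.prod_sum, pauliOp_toEuclideanLin_apply, productState,
    RCLike.inner_apply, Finset.sum_mul, Finset.prod_mul_distrib]
  refine Finset.sum_congr rfl fun s _ => Finset.sum_congr rfl fun t _ => ?_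
  rw [map_prod]
  simp only [Complex.star_def]
  ring

lemma inner_productState (k : Λ → Axis) (b b' : Λ → Bool) :
    inner ℂ (productState fun i => (k i, b i)) (productState fun i => (k i, b' i))
      = if b = b' then (1 : ℂ) else 0 := by
  have : (if b = b' then (1 : ℂ) else 0)
      = ∏ i, ∑ s, star (qubitState (k i, b i) s) * qubitState (k i, b' i) s := by
    simp only [qubitState_orthonormal]
    by_cases h : b = b'
    · simp [h]
    · obtain ⟨i, hi⟩ := Function.ne_iff.mp h
      rw [if_neg h, Finset.prod_eq_zero (Finset.mem_univ i) (if_neg hi)]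
  rw [this, PiLp.inner_apply]
  simp_rw [Fintype.prod_sum, productState, RCLike.inner_apply, map_prod,
    Finset.prod_mul_distrib, mul_comm, Complex.star_def]

lemma norm_productState (ψ : ProductLabel Λ) : ‖productState ψ‖ = 1 := by
  have h := inner_productState (fun i => (ψ i).1) (fun i => (ψ i).2) (fun i => (ψ i).2)
  rw [if_pos rfl] at h
  rw [norm_eq_sqrt_re_inner (𝕜 := ℂ), h]; simp

lemma pauliOp_productState (P : PauliString Λ) (ψ : ProductLabel Λ)
    (h : ∀ i, P i = none ∨ P i = some (ψ i).1) :
    Matrix.toEuclideanLin (pauliOp P) (productState ψ)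
      = (pauliChar P ψ : ℂ) • productState ψ := by
  ext s
  rw [pauliOp_toEuclideanLin_apply, PiLp.smul_apply, smul_eq_mul, pauliChar, Complex.ofReal_prod]
  simp only [productState]
  simp_rw [← Finset.prod_mul_distrib]
  rw [← Fintype.prod_sum (fun i t => sigma' (P i) (s i) t * qubitState (ψ i) t)]
  exact Finset.prod_congr rfl fun i _ => sigma'_eigen _ _ _ (h i) _

lemma trace_pauliOp {P : PauliString Λ} (h : P ≠ fun _ => none) : (pauliOp P).trace = 0 := by
  obtain ⟨i, hi⟩ := Function.ne_iff.mp h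
  simp only [Matrix.trace, Matrix.diag, pauliOp, Matrix.of_apply]
  rw [← Fintype.prod_sum (fun i s => sigma' (P i) s s)]
  refine Finset.prod_eq_zero (Finset.mem_univ i) ?_
  rcases hP : P i with _ | k
  · exact absurd hP hi
  · cases k <;> simp [sigma', sigma]

lemma trace_hamiltonian {c : PauliString Λ → ℝ} (h : c (fun _ => none) = 0) :
    (hamiltonian c).trace = 0 := by
  rw [hamiltonian, Matrix.trace_sum]
  refine Finset.sum_eq_zero fun P _ => ?_
  rw [Matrix.trace_smul]
  by_cases hP : P = fun _ => none
  · subst hP; simp [h]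
  · rw [trace_pauliOp hP, smul_zero]

lemma inner_hamiltonian (c : PauliString Λ → ℝ) (v : Hilb Λ) :
    inner ℂ v (Matrix.toEuclideanLin (hamiltonian c) v)
      = ∑ P, (c P : ℂ) * inner ℂ v (Matrix.toEuclideanLin (pauliOp P) v) := by
  rw [hamiltonian, map_sum, LinearMap.sum_apply, inner_sum]
  simp only [map_smul, LinearMap.smul_apply, inner_smul_right]

lemma energy_productState (c : PauliString Λ → ℝ) (ψ : ProductLabel Λ) :
    energy (hamiltonian c) (productState ψ) = ∑ P, c P * pauliChar P ψ := by
  rw [energy, inner_hamiltonian, Complex.re_sum]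
  refine Finset.sum_congr rfl fun P _ => ?_
  rw [inner_pauliOp_productState, ← Complex.ofReal_mul, Complex.ofReal_re]

lemma finrank_hilb : Module.finrank ℂ (Hilb Λ) = 2 ^ Fintype.card Λ := by simp

/-- The orthonormal basis of the product states with a given axis at each site. -/
lemma exists_product_basis (k : Λ → Axis) :
    ∃ v : OrthonormalBasis (Λ → Bool) ℂ (Hilb Λ),
      ∀ b, v b = productState fun i => (k i, b i) := by
  have ho : Orthonormal ℂ fun b : Λ → Bool => productState fun i => (k i, b i) :=
    orthonormal_iff_ite.mpr fun b b' => inner_productState k b b'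
  obtain ⟨v, hv⟩ := Orthonormal.exists_orthonormalBasis_extension_of_card_eq
    (𝕜 := ℂ) (E := Hilb Λ) (ι := Λ → Bool) (by simp)
    (v := fun b : Λ → Bool => productState fun i => (k i, b i)) (s := Set.univ)
    (ho.comp _ Subtype.val_injective)
  exact ⟨v, fun b => hv b trivial⟩

end

/-! ### Fourth moments and the mean inverse effective dimension. -/

/-- One-qubit fourth-moment bound for the six states, with values in an inner product space. -/
lemma sum_norm_pow_four_six {E : Type*} [NormedAddCommGroup E] [InnerProductSpace ℂ E]
    (u v : E) :
    ∑ a, ‖qubitState a 0 • u + qubitState a 1 • v‖ ^ 4 ≤ 2 * (‖u‖ ^ 2 + ‖v‖ ^ 2) ^ 2 := by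
  have hsq : ∀ w : ℂ, ‖w‖ = 1 → ‖(1 / (Real.sqrt 2 : ℂ)) • u + (w / (Real.sqrt 2 : ℂ)) • v‖ ^ 4
      = ((‖u‖ ^ 2 + ‖v‖ ^ 2 + 2 * (w * inner ℂ u v).re) / 2) ^ 2 := by
    intro w hw
    have h1 : (1 / (Real.sqrt 2 : ℂ)) • u + (w / (Real.sqrt 2 : ℂ)) • v
        = ((Real.sqrt 2 : ℂ)⁻¹) • (u + w • v) := by
      rw [smul_add, smul_smul, one_div, div_eq_mul_inv, mul_comm w]
    have h2 : ‖u + w • v‖ ^ 2 = ‖u‖ ^ 2 + ‖v‖ ^ 2 + 2 * (w * inner ℂ u v).re := by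
      rw [@norm_add_sq ℂ, inner_smul_right, norm_smul, hw]
      simp only [RCLike.re_to_complex]; ring
    have h3 : ‖((Real.sqrt 2 : ℂ)⁻¹)‖ ^ 2 = 1 / 2 := by
      rw [← norm_pow, inv_ofReal_sqrt_two_sq]; norm_num
    rw [h1, norm_smul, show (4 : ℕ) = 2 * 2 from rfl, pow_mul, mul_pow, h2, h3]; ring
  -- With `S = ‖u‖² + ‖v‖²`, the `z` states contribute `‖u‖⁴ + ‖v‖⁴` and the `x` and `y` states `S²
  -- + 2 |⟨u,v⟩|²`; Cauchy–Schwarz bounds the total by `2 S²`.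
  have hz : ‖inner ℂ u v‖ ^ 2 ≤ ‖u‖ ^ 2 * ‖v‖ ^ 2 := by
    rw [← mul_pow]; exact pow_le_pow_left₀ (norm_nonneg _) (norm_inner_le_norm _ _) 2
  rw [← Complex.normSq_eq_norm_sq, Complex.normSq_apply] at hz
  rw [Fintype.sum_prod_type, sum_axis]
  simp only [Fintype.sum_bool, qubitState, sgn, Matrix.cons_val_zero, Matrix.cons_val_one,
    if_true, Bool.false_eq_true, if_false, one_smul, zero_smul, add_zero, zero_add]
  rw [hsq 1 (by simp), hsq (-1) (by simp), hsq (1 * Complex.I) (by simp),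
    hsq (-1 * Complex.I) (by simp)]
  simp only [one_mul, neg_mul, Complex.neg_re, Complex.I_mul_re, neg_neg]
  nlinarith [hz]

/-- Induction on the sites. Contracting one site with its state `a` leaves the vector `qubitState a
0 • u 0 + qubitState a 1 • u 1` on the others, where `u 0`, `u 1` are the slices of `φ`; this is why
the one-qubit bound is needed for vectors rather than scalars. -/
lemma sum_norm_pow_four_le {Λ : Type} [Fintype Λ] [DecidableEq Λ] (φ : (Λ → Fin 2) → ℂ) :
    ∑ ψ : ProductLabel Λ, ‖∑ s, φ s * ∏ i, qubitState (ψ i) (s i)‖ ^ 4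
      ≤ 2 ^ Fintype.card Λ * (∑ s, ‖φ s‖ ^ 2) ^ 2 := by
  refine Fintype.induction_empty_option (P := fun Λ _ => ∀ (φ : (Λ → Fin 2) → ℂ) (_ : DecidableEq Λ),
    ∑ ψ : ProductLabel Λ, ‖∑ s, φ s * ∏ i, qubitState (ψ i) (s i)‖ ^ 4
      ≤ 2 ^ Fintype.card Λ * (∑ s, ‖φ s‖ ^ 2) ^ 2) ?_ ?_ ?_ Λ φ _
  · intro α β _ g ih φ _
    classical
    let _ := Fintype.ofEquiv β g.symm
    have h := ih (fun s => φ (s ∘ g.symm)) inferInstance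
    rw [Fintype.card_congr g] at h
    convert h using 2
    · refine Fintype.sum_equiv (g.symm.arrowCongr (Equiv.refl _)) _ _ fun ψ => ?_
      congr 2
      refine Fintype.sum_equiv (g.symm.arrowCongr (Equiv.refl _)) _ _ fun s => ?_
      congr 1
      · congr 1; ext i; simp [Equiv.arrowCongr]
      · refine Fintype.prod_equiv g.symm _ _ fun i => ?_
        simp [Equiv.arrowCongr]
    · congr 1
      refine Fintype.sum_equiv (g.symm.arrowCongr (Equiv.refl _)) _ _ fun s => ?_
      congr 2; congr 1; ext i; simp [Equiv.arrowCongr]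
  · intro φ _
    simp [← pow_mul]
  · intro Λ _ ih φ _
    classical
    have e1 : ∀ {A : Type} [AddCommMonoid A] {X : Type} [Fintype X] (g : (Option Λ → X) → A),
        ∑ ψ, g ψ = ∑ a, ∑ ψ : Λ → X,
          g ((Equiv.piOptionEquivProd (α := Λ) (β := fun _ => X)).symm (a, ψ)) := by
      intro A _ X _ g
      rw [← Fintype.sum_prod_type']
      exact (Fintype.sum_equiv (Equiv.piOptionEquivProd (α := Λ) (β := fun _ => X)).symm _ _
        fun _ => rfl).symm
    let u : Fin 2 → EuclideanSpace ℂ (Λ → Fin 2) := fun x => WithLp.toLp 2 fun s =>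
      φ ((Equiv.piOptionEquivProd (α := Λ) (β := fun _ => Fin 2)).symm (x, s))
    have hR : ∑ s, ‖φ s‖ ^ 2 = ‖u 0‖ ^ 2 + ‖u 1‖ ^ 2 := by
      rw [e1, Fin.sum_univ_two, EuclideanSpace.norm_sq_eq, EuclideanSpace.norm_sq_eq]
    rw [hR, Fintype.card_option, pow_succ, mul_assoc]
    refine le_trans ?_ (mul_le_mul_of_nonneg_left (sum_norm_pow_four_six (u 0) (u 1))
      (by positivity))
    rw [e1, Finset.mul_sum]
    refine Finset.sum_le_sum fun a _ => ?_
    have h := ih (fun s => (qubitState a 0 • u 0 + qubitState a 1 • u 1) s) inferInstance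
    rw [← EuclideanSpace.norm_sq_eq, ← pow_mul] at h
    refine le_trans (le_of_eq ?_) h
    refine Finset.sum_congr rfl fun ψ _ => ?_
    congr 2
    rw [e1, Fin.sum_univ_two, ← Finset.sum_add_distrib]
    refine Finset.sum_congr rfl fun s _ => ?_
    simp only [Fintype.prod_option, Equiv.piOptionEquivProd_symm_apply, PiLp.add_apply,
      PiLp.smul_apply, smul_eq_mul, u]
    ring

section
variable {Λ : Type} [Fintype Λ] [DecidableEq Λ]

lemma sum_inner_productState_pow_four_le (v : Hilb Λ) :
    ∑ ψ : ProductLabel Λ, ‖(inner ℂ v (productState ψ) : ℂ)‖ ^ 4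
      ≤ 2 ^ Fintype.card Λ * ‖v‖ ^ 4 := by
  have h := sum_norm_pow_four_le fun s => (starRingEnd ℂ) (v s)
  simp only [RCLike.norm_conj] at h
  rw [← EuclideanSpace.norm_sq_eq, ← pow_mul] at h
  refine le_trans (le_of_eq ?_) h
  refine Finset.sum_congr rfl fun ψ _ => ?_
  simp [PiLp.inner_apply, productState, mul_comm]

lemma sum_one_div_effDim_le {J : Type} [Fintype J] (e : OrthonormalBasis J ℂ (Hilb Λ)) :
    ∑ ψ : ProductLabel Λ, 1 / effDim e (productState ψ) ≤ 4 ^ Fintype.card Λ := by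
  simp only [effDim, one_div, inv_inv]
  rw [Finset.sum_comm]
  have hJ : Fintype.card J = 2 ^ Fintype.card Λ := by
    rw [← finrank_hilb (Λ := Λ), Module.finrank_eq_card_basis e.toBasis]
  refine (Finset.sum_le_sum fun j _ => sum_inner_productState_pow_four_le (e j)).trans ?_
  simp only [e.norm_eq_one, one_pow, mul_one, Finset.sum_const, Finset.card_univ, hJ,
    nsmul_eq_mul]
  push_cast
  rw [← mul_pow]; norm_num

lemma effDim_pos {J : Type} [Fintype J] (e : OrthonormalBasis J ℂ (Hilb Λ))
    (ψ : ProductLabel Λ) : 0 < effDim e (productState ψ) := by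
  rw [effDim, inv_pos]
  refine lt_of_le_of_ne (Finset.sum_nonneg fun _ _ => by positivity) fun h => ?_
  have h0 := (Finset.sum_eq_zero_iff_of_nonneg fun _ _ => by positivity).mp h.symm
  have h1 := e.sum_sq_norm_inner_right (productState ψ)
  rw [norm_productState, Finset.sum_eq_zero] at h1
  · norm_num at h1
  · intro j hj
    have := h0 j hj
    rw [pow_eq_zero_iff (by norm_num)] at this
    rw [this]; norm_num

end

/-! ### Combinatorial lemmas: independent sets, paths, fixing coordinates. -/

/-- A relation of bounded degree has an independent set that carries a fixed fraction of the
weight. -/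
lemma exists_independent_weight {α : Type*} [DecidableEq α] (R : α → α → Prop)
    [DecidableRel R] (T : Finset α) (hrefl : ∀ x ∈ T, R x x) (hsymm : ∀ x y, R x y → R y x) (M : ℕ)
    (w : α → ℝ) (hw : ∀ x ∈ T, 0 ≤ w x)
    (hM : ∀ x ∈ T, (T.filter (R x)).card ≤ M) :
    ∃ I ⊆ T, (∀ x ∈ I, ∀ y ∈ I, x ≠ y → ¬ R x y) ∧ ∑ x ∈ T, w x ≤ M * ∑ x ∈ I, w x := by
  induction T using Finset.strongInduction with
  | H T ih =>
    rcases T.eq_empty_or_nonempty with rfl | hne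
    · exact ⟨∅, by simp⟩
    -- Greedy choice: the heaviest element pays for its at most `M` neighbours, which are then
    -- discarded.
    obtain ⟨m, hm, hmax⟩ := T.exists_max_image w hne
    have hsub : T.filter (fun y => ¬ R m y) ⊆ T := Finset.filter_subset _ _
    obtain ⟨I, hI, hind, hsum⟩ := ih (T.filter fun y => ¬ R m y)
      (Finset.ssubset_iff_subset_ne.mpr ⟨hsub, fun h => by
        have h2 := h ▸ hm
        rw [Finset.mem_filter] at h2
        exact h2.2 (hrefl m hm)⟩)
      (fun x hx => hrefl x (hsub hx)) (fun x hx => hw x (hsub hx))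
      (fun x hx => (Finset.card_le_card (Finset.filter_subset_filter _ hsub)).trans
        (hM x (hsub hx)))
    have hmI : ∀ y ∈ I, ¬ R m y := fun y hy => (Finset.mem_filter.mp (hI hy)).2
    refine ⟨insert m I, ?_, ?_, ?_⟩
    · exact Finset.insert_subset hm (hI.trans hsub)
    · intro x hx y hy hxy
      rcases Finset.mem_insert.mp hx with rfl | hx' <;> rcases Finset.mem_insert.mp hy with rfl | hy'
      · exact absurd rfl hxy
      · exact hmI y hy'
      · exact fun h => hmI x hx' (hsymm _ _ h)
      · exact hind x hx' y hy' hxy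
    · rw [Finset.sum_insert fun h => hmI m h (hrefl m hm), mul_add,
        ← Finset.sum_filter_add_sum_filter_not T (R m)]
      refine add_le_add ?_ hsum
      calc ∑ x ∈ T.filter (R m), w x ≤ (T.filter (R m)).card • w m :=
            Finset.sum_le_card_nsmul _ _ _ fun x hx => hmax x (Finset.mem_filter.mp hx).1
        _ ≤ M * w m := by
            rw [nsmul_eq_mul]
            exact mul_le_mul_of_nonneg_right (by exact_mod_cast hM m hm) (hw m hm)

/-- Every path between the two sides of a level, changing one site at a time, meets the shell
around the level; counting the pairs of end points bounds the size of the shell from below. -/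
lemma card_mul_card_le_card_shell {Λ α : Type*} [Fintype Λ] [DecidableEq Λ] [Fintype α]
    [DecidableEq α] (f : (Λ → α) → ℝ) (K E : ℝ)
    (hf : ∀ x y : Λ → α, ∀ i, (∀ j, j ≠ i → x j = y j) → f x - f y ≤ K) :
    (Finset.univ.filter fun x => E ≤ f x).card * (Finset.univ.filter fun x => f x < E).card ≤
      Fintype.card Λ * ((Finset.univ.filter fun x => |f x - E| ≤ K).card *
        Fintype.card (Λ → α)) := by
  set N := Fintype.card Λ with hN
  let g : Λ ≃ Fin N := Fintype.equivFin Λ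
  -- The path from `y` to `x`: the first `k` sites are already those of `x`. At its first crossing
  -- of `E` from below it overshoots by at most `K`.
  let hyb : ℕ → (Λ → α) → (Λ → α) → (Λ → α) := fun k x y i => if (g i : ℕ) < k then x i else y i
  have hyb0 : ∀ x y, hyb 0 x y = y := fun x y => by funext i; simp [hyb]
  have hybN : ∀ x y, hyb N x y = x := fun x y => by funext i; simp [hyb]
  have key : ∀ p : (Λ → α) × (Λ → α), E ≤ f p.1 → f p.2 < E →
      ∃ k : ℕ, k < N ∧ |f (hyb (k + 1) p.1 p.2) - E| ≤ K := by
    rintro ⟨x, y⟩ hx hy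
    have hex : ∃ k, E ≤ f (hyb k x y) := ⟨N, by rwa [hybN]⟩
    classical
    have hk := Nat.find_spec hex
    have hk0 : Nat.find hex ≠ 0 := fun h => by
      rw [h, hyb0] at hk; exact absurd hy (not_lt.mpr hk)
    have hkN : Nat.find hex ≤ N := Nat.find_min' hex (by rwa [hybN])
    obtain ⟨k, hkk⟩ := Nat.exists_eq_succ_of_ne_zero hk0
    rw [hkk] at hk hkN
    have hlt : f (hyb k x y) < E := not_le.mp (Nat.find_min hex (by omega))
    refine ⟨k, by omega, ?_⟩
    have := hf (hyb (k + 1) x y) (hyb k x y) (g.symm ⟨k, by omega⟩) fun j hj => by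
      have hne : (g j : ℕ) ≠ k := fun h => hj (by
        rw [Equiv.eq_symm_apply]; exact Fin.ext h)
      simp only [hyb]
      by_cases h : (g j : ℕ) < k
      · rw [if_pos h, if_pos (by omega)]
      · rw [if_neg h, if_neg (by omega)]
    simp only [Nat.succ_eq_add_one] at hk
    rw [abs_le]; constructor <;> simp only <;> linarith
  choose! k hk using key
  rw [← Finset.card_product, ← Finset.card_univ (α := Λ → α), ← Finset.card_product,
    ← Finset.card_range N, ← Finset.card_product]
  -- The hybrid alone does not determine the pair. Together with the crossing index and the
  -- complementary hybrid it does, since each site value of `x` and `y` appears in one of the two.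
  refine Finset.card_le_card_of_injOn
    (fun p => (k p, hyb (k p + 1) p.1 p.2, hyb (k p + 1) p.2 p.1)) ?_ ?_
  · rintro p hp
    simp only [Finset.coe_product, Finset.coe_filter, Finset.mem_univ, true_and, Set.mem_prod,
      Set.mem_ofPred_eq, Finset.coe_univ, Set.mem_univ, and_true, Finset.coe_range,
      Set.mem_Iio] at hp ⊢
    exact hk p hp.1 hp.2
  · rintro p - q - hpq
    simp only [Prod.mk.injEq] at hpq
    obtain ⟨h1, h2, h3⟩ := hpq
    rw [h1] at h2 h3
    have e : ∀ i, p.1 i = q.1 i ∧ p.2 i = q.2 i := fun i => by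
      have a1 := congrFun h2 i
      have a2 := congrFun h3 i
      simp only [hyb] at a1 a2
      split_ifs at a1 a2 <;> exact ⟨by assumption, by assumption⟩
    exact Prod.ext (funext fun i => (e i).1) (funext fun i => (e i).2)

/-- A function bounded by `B` whose mean is at least `2 ε` is at least `ε` on a fraction `ε / B` of
the points. -/
lemma mul_card_le_card_filter_mul {X : Type*} [Fintype X] (h : X → ℝ) (B ε : ℝ)
    (hB : ∀ x, h x ≤ B) (hmean : 2 * ε * Fintype.card X ≤ ∑ x, h x) (hε : 0 ≤ ε) :
    ε * Fintype.card X ≤ (Finset.univ.filter fun x => ε ≤ h x).card * B := by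
  have h1 := Finset.sum_filter_add_sum_filter_not Finset.univ (fun x => ε ≤ h x) h
  have h2 : ∑ x ∈ Finset.univ.filter (fun x => ε ≤ h x), h x
      ≤ (Finset.univ.filter fun x => ε ≤ h x).card * B := by
    rw [← nsmul_eq_mul]; exact Finset.sum_le_card_nsmul _ _ _ fun x _ => hB x
  have h3 : ∑ x ∈ Finset.univ.filter (fun x => ¬ ε ≤ h x), h x ≤ Fintype.card X * ε := by
    refine (Finset.sum_le_card_nsmul _ _ ε fun x hx =>
      (not_le.mp (Finset.mem_filter.mp hx).2).le).trans ?_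
    rw [nsmul_eq_mul]
    exact mul_le_mul_of_nonneg_right (by exact_mod_cast Finset.card_le_univ _) hε
  linarith

/-- Fixing the values on `R` loses at most a factor `|α| ^ |R|` in the cardinality of a set. -/
lemma card_filter_piecewise_le {Λ α : Type*} [Fintype Λ] [DecidableEq Λ] [Fintype α]
    [DecidableEq α] (R : Finset Λ) (x : Λ → α) (p : (Λ → α) → Prop) [DecidablePred p] :
    (Finset.univ.filter fun y => p (R.piecewise x y)).card
      ≤ (Finset.univ.filter p).card * Fintype.card α ^ R.card := by
  have hc : Fintype.card α ^ R.card = Fintype.card (R → α) := by simp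
  rw [hc, ← Finset.card_univ (α := R → α), ← Finset.card_product]
  refine Finset.card_le_card_of_injOn (fun y => (R.piecewise x y, fun i => y i)) ?_ ?_
  · intro y hy
    simpa using hy
  · rintro y - z - h
    simp only [Prod.mk.injEq] at h
    funext i
    by_cases hi : i ∈ R
    · exact congrFun h.2 ⟨i, hi⟩
    · simpa [hi] using congrFun h.1 i

/-! ### Sparse Hamiltonians: extensive energies of product states. -/

section
variable {Λ : Type} [Fintype Λ] [DecidableEq Λ]

/-- The Pauli operators that occur in the Hamiltonian. -/
noncomputable def terms (c : PauliString Λ → ℝ) : Finset (PauliString Λ) :=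
  Finset.univ.filter fun P => c P ≠ 0

/-- The Pauli operators that occur in the Hamiltonian and act on the site `i`. -/
noncomputable def termsAt (c : PauliString Λ → ℝ) (i : Λ) : Finset (PauliString Λ) :=
  (terms c).filter fun P => i ∈ supp P

/-- Two Pauli operators conflict if a term of the Hamiltonian overlaps with both. -/
def Conflict (c : PauliString Λ → ℝ) (P P' : PauliString Λ) : Prop :=
  ∃ Q ∈ terms c, (∃ i ∈ supp P, i ∈ supp Q) ∧ ∃ j ∈ supp P', j ∈ supp Q

/-- A traceless Hamiltonian whose terms act on at most `V` sites, with at most `D` terms at each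
site and coefficients in `[a, b]` up to sign. -/
structure IsSparse (c : PauliString Λ → ℝ) (V D : ℕ) (a b : ℝ) : Prop where
  traceless : c (fun _ => none) = 0
  card_supp_le : ∀ P, c P ≠ 0 → (supp P).card ≤ V
  card_termsAt_le : ∀ i, (termsAt c i).card ≤ D
  le_abs : ∀ P, c P ≠ 0 → a ≤ |c P|
  abs_le : ∀ P, |c P| ≤ b

lemma mem_terms {c : PauliString Λ → ℝ} {P : PauliString Λ} : P ∈ terms c ↔ c P ≠ 0 := by
  simp [terms]

lemma mem_termsAt {c : PauliString Λ → ℝ} {P : PauliString Λ} {i : Λ} :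
    P ∈ termsAt c i ↔ c P ≠ 0 ∧ i ∈ supp P := by
  simp [termsAt, mem_terms]

lemma terms_neg (c : PauliString Λ → ℝ) : terms (-c) = terms c := by
  ext P; simp [mem_terms]

lemma Conflict.symm {c : PauliString Λ → ℝ} {P P' : PauliString Λ} (h : Conflict c P P') :
    Conflict c P' P := by
  obtain ⟨Q, hQ, h1, h2⟩ := h
  exact ⟨Q, hQ, h2, h1⟩

namespace IsSparse
variable {c : PauliString Λ → ℝ} {V D : ℕ} {a b : ℝ}

lemma neg (h : IsSparse c V D a b) : IsSparse (-c) V D a b where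
  traceless := by simp [h.traceless]
  card_supp_le P hP := h.card_supp_le P (by simpa using hP)
  card_termsAt_le i := by simpa only [termsAt, terms_neg] using h.card_termsAt_le i
  le_abs P hP := by simpa using h.le_abs P (by simpa using hP)
  abs_le P := by simpa using h.abs_le P

lemma nonneg (h : IsSparse c V D a b) : 0 ≤ b := (abs_nonneg _).trans (h.abs_le fun _ => none)

lemma exists_mem_supp (h : IsSparse c V D a b) {P : PauliString Λ} (hP : c P ≠ 0) :
    ∃ i, i ∈ supp P := by
  by_contra! hc
  refine hP ?_
  rw [show P = fun _ => none from funext fun i => by simpa [mem_supp] using hc i, h.traceless]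

lemma conflict_self (h : IsSparse c V D a b) {P : PauliString Λ} (hP : P ∈ terms c) :
    Conflict c P P := by
  obtain ⟨i, hi⟩ := h.exists_mem_supp (mem_terms.mp hP)
  exact ⟨P, hP, ⟨i, hi, hi⟩, ⟨i, hi, hi⟩⟩

-- A conflict is reached in two moves, from `P` to an overlapping `Q` and from `Q` to an overlapping
-- `P'`, each with at most `V * D` choices.
open scoped Classical in
lemma card_conflict_le (h : IsSparse c V D a b) {P : PauliString Λ} (hP : P ∈ terms c) :
    ((terms c).filter (Conflict c P)).card ≤ V * D * (V * D) := by
  have h1 : ∀ Q ∈ terms c, ((supp Q).biUnion (termsAt c)).card ≤ V * D := fun Q hQ =>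
    (Finset.card_biUnion_le_card_mul _ _ D fun i _ => h.card_termsAt_le i).trans
      (Nat.mul_le_mul_right _ (h.card_supp_le Q (mem_terms.mp hQ)))
  refine (Finset.card_le_card (t := ((supp P).biUnion (termsAt c)).biUnion
    fun Q => (supp Q).biUnion (termsAt c)) fun P' hP' => ?_).trans
      ((Finset.card_biUnion_le_card_mul _ _ (V * D) fun Q hQ => h1 Q ?_).trans
        (Nat.mul_le_mul_right _ (h1 P hP)))
  · obtain ⟨hP', Q, hQ, ⟨i, hi, hi'⟩, ⟨j, hj, hj'⟩⟩ := Finset.mem_filter.mp hP'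
    simp only [Finset.mem_biUnion, mem_termsAt]
    exact ⟨Q, ⟨i, hi, mem_terms.mp hQ, hi'⟩, j, hj', mem_terms.mp hP', hj⟩
  · obtain ⟨i, -, hi⟩ := Finset.mem_biUnion.mp hQ
    exact mem_terms.mpr (mem_termsAt.mp hi).1

lemma exists_conflict_free (h : IsSparse c V D a b) (w : PauliString Λ → ℝ) (hw : ∀ P, 0 ≤ w P) :
    ∃ T ⊆ terms c, (∀ P ∈ T, ∀ P' ∈ T, P ≠ P' → ¬ Conflict c P P') ∧
      ∑ P ∈ terms c, w P ≤ (V * D * (V * D) : ℕ) * ∑ P ∈ T, w P := by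
  classical
  exact exists_independent_weight (Conflict c) _ (fun P hP => h.conflict_self hP)
    (fun _ _ => Conflict.symm) _ w (fun P _ => hw P) fun P hP => h.card_conflict_le hP

lemma card_terms_le (h : IsSparse c V D a b) : (terms c).card ≤ Fintype.card Λ * D := by
  refine (Finset.card_le_card (t := Finset.univ.biUnion (termsAt c)) fun P hP => ?_).trans
    (Finset.card_biUnion_le_card_mul _ _ D fun i _ => h.card_termsAt_le i)
  obtain ⟨i, hi⟩ := h.exists_mem_supp (mem_terms.mp hP)
  exact Finset.mem_biUnion.mpr ⟨i, Finset.mem_univ i, mem_termsAt.mpr ⟨mem_terms.mp hP, hi⟩⟩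

lemma sum_abs_le (h : IsSparse c V D a b) : ∑ P, |c P| ≤ b * D * Fintype.card Λ := by
  rw [← Finset.sum_subset (Finset.subset_univ (terms c)) fun P _ hP => by
    simpa [mem_terms] using hP]
  refine (Finset.sum_le_card_nsmul _ _ b fun P _ => h.abs_le P).trans ?_
  rw [nsmul_eq_mul]
  have : ((terms c).card : ℝ) ≤ Fintype.card Λ * D := by exact_mod_cast h.card_terms_le
  nlinarith [h.nonneg]

end IsSparse

/-- The energy of a product state. -/
noncomputable def productEnergy (c : PauliString Λ → ℝ) (ψ : ProductLabel Λ) : ℝ :=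
  ∑ P, c P * pauliChar P ψ

/-- The part of the energy of a product state due to terms acting inside `R`. -/
noncomputable def energyInside (c : PauliString Λ → ℝ) (R : Finset Λ) (ψ : ProductLabel Λ) : ℝ :=
  ∑ P ∈ Finset.univ.filter fun P => supp P ⊆ R, c P * pauliChar P ψ

lemma card_productLabel : Fintype.card (ProductLabel Λ) = 6 ^ Fintype.card Λ := by
  rw [Fintype.card_fun, Fintype.card_prod, card_axis, Fintype.card_bool]

/-- Averaging over the sites off `R` kills every string that leaves `R`. The sum also runs over the
ignored values of `y` on `R`, so the normalization is `6 ^ N` whatever `R` is. -/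
lemma sum_pauliChar_piecewise (P : PauliString Λ) (R : Finset Λ) (x : ProductLabel Λ) :
    ∑ y, pauliChar P (R.piecewise x y)
      = if supp P ⊆ R then 6 ^ Fintype.card Λ * pauliChar P x else 0 := by
  have h1 : ∀ y, pauliChar P (R.piecewise x y)
      = ∏ i, siteChar (P i) (if i ∈ R then x i else y i) := fun y => rfl
  simp_rw [h1]
  rw [← Fintype.prod_sum fun i z => siteChar (P i) (if i ∈ R then x i else z)]
  split_ifs with h
  · rw [pauliChar, ← Finset.card_univ, ← Finset.prod_const, ← Finset.prod_mul_distrib]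
    refine Finset.prod_congr rfl fun i _ => ?_
    by_cases hi : i ∈ R
    · simp [hi, card_axis]
    · have : P i = none := by
        by_contra hP; exact hi (h (mem_supp.mpr hP))
      simp only [if_neg hi, this, sum_siteChar, if_true]
      simp [siteChar]
  · obtain ⟨i, hi, hiR⟩ := Finset.not_subset.mp h
    refine Finset.prod_eq_zero (Finset.mem_univ i) ?_
    simp only [if_neg hiR, sum_siteChar, if_neg (mem_supp.mp hi)]

lemma sum_pauliChar_mul_self_piecewise (P : PauliString Λ) (R : Finset Λ) (x : ProductLabel Λ)
    (hR : Disjoint (supp P) R) :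
    ∑ y, pauliChar P y * pauliChar P (R.piecewise x y)
      = 6 ^ Fintype.card Λ * (1 / 3) ^ (supp P).card := by
  have h1 : ∀ y, pauliChar P y * pauliChar P (R.piecewise x y)
      = ∏ i, siteChar (P i) (y i) * siteChar (P i) (if i ∈ R then x i else y i) := fun y => by
    rw [Finset.prod_mul_distrib]; rfl
  simp_rw [h1]
  rw [← Fintype.prod_sum fun i z => siteChar (P i) z * siteChar (P i) (if i ∈ R then x i else z),
    ← Finset.card_univ, ← Finset.prod_const, ← Finset.prod_const, supp, Finset.prod_filter,
    ← Finset.prod_mul_distrib]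
  refine Finset.prod_congr rfl fun i _ => ?_
  by_cases hP : P i = none
  · simp [hP, siteChar, card_axis]
  · have hi : i ∉ R := fun hi => Finset.disjoint_left.mp hR (mem_supp.mpr hP) hi
    simp only [if_neg hi, sum_siteChar_mul, if_true, if_neg hP, ne_eq]
    rw [if_pos hP]; norm_num

/-- The sum vanishes once `P` and `Q` differ at a site off `R`. If they agreed there, `Q` would
overlap `P` and hence avoid `R` by `hQ`; as `P` also avoids `R`, this would force `Q = P`. -/
lemma sum_pauliChar_mul_piecewise_of_ne {P Q : PauliString Λ} (R : Finset Λ) (x : ProductLabel Λ)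
    (hR : Disjoint (supp P) R) (hP : ∃ i, i ∈ supp P) (hne : Q ≠ P)
    (hQ : (∃ i ∈ supp P, i ∈ supp Q) → ∀ j ∈ R, j ∉ supp Q) :
    ∑ y, pauliChar P y * pauliChar Q (R.piecewise x y) = 0 := by
  have h1 : ∀ y, pauliChar P y * pauliChar Q (R.piecewise x y)
      = ∏ i, siteChar (P i) (y i) * siteChar (Q i) (if i ∈ R then x i else y i) := fun y => by
    rw [Finset.prod_mul_distrib]; rfl
  simp_rw [h1]
  rw [← Fintype.prod_sum fun i z => siteChar (P i) z * siteChar (Q i) (if i ∈ R then x i else z)]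
  have : ∃ i ∉ R, P i ≠ Q i := by
    by_contra! hc
    obtain ⟨j, hj⟩ := Function.ne_iff.mp hne
    have hjR : j ∈ R := by
      by_contra hjR; exact hj (hc j hjR).symm
    have hPj : P j = none := by
      by_contra h; exact Finset.disjoint_left.mp hR (mem_supp.mpr h) hjR
    obtain ⟨i, hi⟩ := hP
    have hPi := hc i fun hiR => Finset.disjoint_left.mp hR hi hiR
    exact hQ ⟨i, hi, mem_supp.mpr (hPi ▸ mem_supp.mp hi)⟩ j hjR (mem_supp.mpr (hPj ▸ hj))
  obtain ⟨i, hiR, hi⟩ := this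
  refine Finset.prod_eq_zero (Finset.mem_univ i) ?_
  simp only [if_neg hiR, sum_siteChar_mul, if_neg hi]

lemma sum_productEnergy_piecewise (c : PauliString Λ → ℝ) (R : Finset Λ) (x : ProductLabel Λ) :
    ∑ y, productEnergy c (R.piecewise x y) = 6 ^ Fintype.card Λ * energyInside c R x := by
  simp only [productEnergy, energyInside]
  rw [Finset.sum_comm, Finset.mul_sum, Finset.sum_filter]
  refine Finset.sum_congr rfl fun P _ => ?_
  rw [← Finset.mul_sum, sum_pauliChar_piecewise]
  split_ifs <;> ring

lemma sum_energyInside_piecewise (c : PauliString Λ → ℝ) {R S : Finset Λ} (hRS : R ⊆ S)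
    (x : ProductLabel Λ) :
    ∑ y, energyInside c S (R.piecewise x y) = 6 ^ Fintype.card Λ * energyInside c R x := by
  simp only [energyInside]
  rw [Finset.sum_comm, Finset.mul_sum, Finset.sum_filter, Finset.sum_filter]
  refine Finset.sum_congr rfl fun P _ => ?_
  rw [← Finset.mul_sum, sum_pauliChar_piecewise]
  by_cases h : supp P ⊆ R
  · rw [if_pos (h.trans hRS), if_pos h, if_pos h]; ring
  · rw [if_neg h, if_neg h, mul_zero, ite_self]

lemma sum_pauliChar_mul_energyInside (c : PauliString Λ → ℝ) {P : PauliString Λ} {R : Finset Λ}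
    (hR : Disjoint (supp P) R) (hP : ∃ i, i ∈ supp P)
    (hQ : ∀ Q ∈ terms c, (∃ i ∈ supp P, i ∈ supp Q) → ∀ j ∈ R, j ∉ supp Q)
    (x : ProductLabel Λ) :
    ∑ y, pauliChar P y * energyInside c (R ∪ supp P) (R.piecewise x y)
      = 6 ^ Fintype.card Λ * (c P * (1 / 3) ^ (supp P).card) := by
  simp only [energyInside, Finset.mul_sum]
  rw [Finset.sum_comm, Finset.sum_eq_single P]
  · simp_rw [mul_left_comm _ (c P)]
    rw [← Finset.mul_sum, sum_pauliChar_mul_self_piecewise P R x hR]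
  · intro Q _ hne
    simp_rw [mul_left_comm _ (c Q)]
    rw [← Finset.mul_sum]
    by_cases hc : c Q = 0
    · rw [hc, zero_mul]
    · rw [sum_pauliChar_mul_piecewise_of_ne R x hR hP hne (hQ Q (mem_terms.mpr hc)), mul_zero]
  · intro h
    exact absurd (Finset.mem_filter.mpr ⟨Finset.mem_univ P, Finset.subset_union_right⟩) h

lemma exists_le_of_weighted_sum {X : Type*} [Fintype X] (w g : X → ℝ) (m : ℝ)
    (hw : ∀ x, 0 ≤ w x) (hpos : 0 < ∑ x, w x) (h : m * ∑ x, w x ≤ ∑ x, w x * g x) :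
    ∃ x, m ≤ g x := by
  by_contra! hc
  obtain ⟨x, hx, hx'⟩ := (Finset.sum_pos_iff_of_nonneg fun x _ => hw x).mp hpos
  have : ∑ x, w x * g x < ∑ x, w x * m := Finset.sum_lt_sum
    (fun x _ => mul_le_mul_of_nonneg_left (hc x).le (hw x))
    ⟨x, hx, mul_lt_mul_of_pos_left (hc x) hx'⟩
  rw [← Finset.sum_mul] at this
  linarith

namespace IsSparse
variable {c : PauliString Λ → ℝ} {V D : ℕ} {a b : ℝ}

/-- Keep `x` on `R` and draw the rest with the nonnegative weight `1 + s * pauliChar P y`, `s` being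
the sign of `c P`. The constant part reproduces the energy inside `R`; by orthogonality the tilt
sees only the term `P` and gains `|c P|` times `1 / 3` per site of its support. Some `y` attains
this mean. -/
lemma exists_energyInside_union_ge (h : IsSparse c V D a b) {P : PauliString Λ}
    {R : Finset Λ} (hPc : P ∈ terms c) (hR : Disjoint (supp P) R)
    (hQ : ∀ Q ∈ terms c, (∃ i ∈ supp P, i ∈ supp Q) → ∀ j ∈ R, j ∉ supp Q)
    (x : ProductLabel Λ) :
    ∃ y, energyInside c R x + a * (1 / 3) ^ V ≤ energyInside c (R ∪ supp P) y := by
  have hcP := mem_terms.mp hPc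
  have hP := h.exists_mem_supp hcP
  obtain ⟨s, hs, hsc⟩ : ∃ s : ℝ, |s| = 1 ∧ s * c P = |c P| := by
    rcases le_total 0 (c P) with h0 | h0
    · exact ⟨1, by simp, by rw [abs_of_nonneg h0, one_mul]⟩
    · exact ⟨-1, by simp, by rw [abs_of_nonpos h0, neg_one_mul]⟩
  have hsum0 : ∑ y, pauliChar P y = 0 := by
    have := sum_pauliChar_piecewise P ∅ x
    simp only [Finset.piecewise_empty] at this
    rw [this, if_neg]
    obtain ⟨i, hi⟩ := hP
    exact fun hsub => Finset.notMem_empty i (hsub hi)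
  have hw : ∑ y, (1 + s * pauliChar P y) = 6 ^ Fintype.card Λ := by
    rw [Finset.sum_add_distrib, ← Finset.mul_sum, hsum0, mul_zero, add_zero, Finset.sum_const,
      Finset.card_univ, card_productLabel]
    simp
  obtain ⟨y, hy⟩ := exists_le_of_weighted_sum (fun y => 1 + s * pauliChar P y)
    (fun y => energyInside c (R ∪ supp P) (R.piecewise x y))
    (energyInside c R x + a * (1 / 3) ^ V) (fun y => by
      have : |s * pauliChar P y| ≤ 1 := by rw [abs_mul, hs, one_mul]; exact abs_pauliChar_le P y
      linarith [neg_abs_le (s * pauliChar P y)])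
    (by rw [hw]; positivity) (by
      rw [hw]
      simp_rw [add_mul, one_mul, mul_assoc]
      rw [Finset.sum_add_distrib, ← Finset.mul_sum,
        sum_energyInside_piecewise c Finset.subset_union_left,
        sum_pauliChar_mul_energyInside c hR hP hQ]
      have h1 : a * (1 / 3) ^ V ≤ |c P| * (1 / 3) ^ (supp P).card :=
        mul_le_mul (h.le_abs P hcP) (pow_le_pow_of_le_one (by norm_num) (by norm_num)
          (h.card_supp_le P hcP)) (by positivity) (abs_nonneg _)
      rw [← hsc] at h1
      have h6 : (0 : ℝ) < 6 ^ Fintype.card Λ := by positivity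
      nlinarith [mul_le_mul_of_nonneg_left h1 h6.le])
  exact ⟨_, hy⟩

/-- The supports are added one at a time. Freedom from conflicts is what makes each new term gain
its full amount without disturbing the sites already fixed. -/
lemma exists_energyInside_ge (h : IsSparse c V D a b) (T : Finset (PauliString Λ))
    (hT : T ⊆ terms c) (hfree : ∀ P ∈ T, ∀ P' ∈ T, P ≠ P' → ¬ Conflict c P P') :
    ∃ x, T.card * (a * (1 / 3) ^ V) ≤ energyInside c (T.biUnion supp) x := by
  classical
  induction T using Finset.induction_on with
  | empty =>
    refine ⟨fun _ => (.x, true), ?_⟩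
    simp only [Finset.card_empty, Nat.cast_zero, zero_mul, Finset.biUnion_empty, energyInside]
    refine Finset.sum_nonneg fun P hP => ?_
    by_cases hc : c P = 0
    · rw [hc, zero_mul]
    · obtain ⟨i, hi⟩ := h.exists_mem_supp hc
      exact absurd ((Finset.mem_filter.mp hP).2 hi) (Finset.notMem_empty i)
  | insert P T hPT ih =>
    obtain ⟨x, hx⟩ := ih ((Finset.subset_insert P T).trans hT) fun P₁ h₁ P₂ h₂ =>
      hfree P₁ (Finset.mem_insert_of_mem h₁) P₂ (Finset.mem_insert_of_mem h₂)
    have hPc : P ∈ terms c := hT (Finset.mem_insert_self P T)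
    have hQ : ∀ Q ∈ terms c, (∃ i ∈ supp P, i ∈ supp Q) → ∀ j ∈ T.biUnion supp, j ∉ supp Q := by
      intro Q hQ hi j hj hjQ
      obtain ⟨P', hP', hj'⟩ := Finset.mem_biUnion.mp hj
      exact hfree P (Finset.mem_insert_self P T) P' (Finset.mem_insert_of_mem hP')
        (fun he => hPT (he ▸ hP')) ⟨Q, hQ, hi, j, hj', hjQ⟩
    have hdis : Disjoint (supp P) (T.biUnion supp) :=
      Finset.disjoint_left.mpr fun i hi hi' => hQ P hPc ⟨i, hi, hi⟩ i hi' hi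
    obtain ⟨y, hy⟩ := h.exists_energyInside_union_ge hPc hdis hQ x
    refine ⟨y, ?_⟩
    rw [Finset.biUnion_insert, Finset.union_comm, Finset.card_insert_of_notMem hPT]
    push_cast
    linarith

lemma abs_productEnergy_le (h : IsSparse c V D a b) (ψ : ProductLabel Λ) :
    |productEnergy c ψ| ≤ b * D * Fintype.card Λ := by
  refine (Finset.abs_sum_le_sum_abs _ _).trans (le_trans ?_ h.sum_abs_le)
  refine Finset.sum_le_sum fun P _ => ?_
  rw [abs_mul]
  exact mul_le_of_le_one_right (abs_nonneg _) (abs_pauliChar_le P ψ)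

/-- A conflict-free set of `k` terms yields many product states of energy at least
`k a / (2 · 3 ^ V)`. -/
lemma card_productEnergy_ge (h : IsSparse c V D a b) (ha : 0 < a) (T : Finset (PauliString Λ))
    (hT : T ⊆ terms c) (hfree : ∀ P ∈ T, ∀ P' ∈ T, P ≠ P' → ¬ Conflict c P P') :
    T.card * (a * (1 / 3) ^ V) / 2 * 6 ^ Fintype.card Λ ≤
      (Finset.univ.filter fun ψ => T.card * (a * (1 / 3) ^ V) / 2 ≤ productEnergy c ψ).card *
        6 ^ (T.card * V) * (b * D * Fintype.card Λ) := by
  obtain ⟨x, hx⟩ := h.exists_energyInside_ge T hT hfree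
  set ε : ℝ := T.card * (a * (1 / 3) ^ V) / 2 with hε
  have h6 : (0 : ℝ) < 6 ^ Fintype.card Λ := by positivity
  have hcard : ((Fintype.card (ProductLabel Λ) : ℕ) : ℝ) = 6 ^ Fintype.card Λ := by
    rw [card_productLabel]; push_cast; rfl
  -- With `x` fixed on the supports, the mean energy over the other sites is `energyInside`, at
  -- least `2 * ε`.
  have h1 := mul_card_le_card_filter_mul
    (fun y => productEnergy c ((T.biUnion supp).piecewise x y)) (b * D * Fintype.card Λ) ε
    (fun y => (le_abs_self _).trans (h.abs_productEnergy_le _))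
    (by rw [hcard, sum_productEnergy_piecewise]; nlinarith) (by positivity)
  rw [hcard] at h1
  refine h1.trans (mul_le_mul_of_nonneg_right ?_
    (mul_nonneg (mul_nonneg h.nonneg (Nat.cast_nonneg _)) (Nat.cast_nonneg _)))
  have h2 := card_filter_piecewise_le (T.biUnion supp) x (fun ψ => ε ≤ productEnergy c ψ)
  have h3 : (T.biUnion supp).card ≤ T.card * V :=
    Finset.card_biUnion_le_card_mul _ _ V fun P hP => h.card_supp_le P (mem_terms.mp (hT hP))
  rw [Fintype.card_prod, card_axis, Fintype.card_bool] at h2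
  exact_mod_cast h2.trans (Nat.mul_le_mul_left _ (Nat.pow_le_pow_right (by norm_num) h3))

/-- Only the at most `D` terms at `i` change, each by at most `2 * b`. This is the window width that
the shell needs. -/
lemma productEnergy_sub_le (h : IsSparse c V D a b) (x y : ProductLabel Λ) (i : Λ)
    (hxy : ∀ j, j ≠ i → x j = y j) : productEnergy c x - productEnergy c y ≤ 2 * b * D := by
  rw [productEnergy, productEnergy, ← Finset.sum_sub_distrib,
    ← Finset.sum_subset (Finset.subset_univ (termsAt c i))]
  · refine (Finset.sum_le_card_nsmul _ _ (2 * b) fun P _ => ?_).trans ?_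
    · rw [← mul_sub]
      refine (le_abs_self _).trans ?_
      rw [abs_mul]
      have h1 := abs_sub (pauliChar P x) (pauliChar P y)
      have := abs_pauliChar_le P x
      have := abs_pauliChar_le P y
      nlinarith [h.abs_le P, abs_nonneg (c P), abs_nonneg (pauliChar P x - pauliChar P y)]
    · rw [nsmul_eq_mul, mul_comm]
      exact mul_le_mul_of_nonneg_left (by exact_mod_cast h.card_termsAt_le i)
        (by linarith [h.nonneg])
  · intro P _ hP
    by_cases hc : c P = 0
    · simp [hc]
    · have hi : P i = none := by
        by_contra hi
        exact hP (mem_termsAt.mpr ⟨hc, mem_supp.mpr hi⟩)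
      rw [sub_eq_zero, pauliChar, pauliChar]
      congr 1
      refine Finset.prod_congr rfl fun j _ => ?_
      by_cases hj : j = i
      · rw [hj, hi]; rfl
      · rw [hxy j hj]

end IsSparse
end

/-! ### Thermal states: the Gibbs variational inequality and high temperature. -/

section Exp
attribute [local instance] Matrix.linftyOpNormedRing Matrix.linftyOpNormedAlgebra

lemma exp_mulVec_of_eigenvector {n : Type*} [Fintype n] [DecidableEq n] (M : Matrix n n ℂ)
    (v : n → ℂ) (μ : ℂ) (h : M.mulVec v = μ • v) :
    (NormedSpace.exp M).mulVec v = Complex.exp μ • v := by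
  have hpow : ∀ k : ℕ, (M ^ k).mulVec v = μ ^ k • v := by
    intro k
    induction k with
    | zero => simp
    | succ k ih => rw [pow_succ, ← Matrix.mulVec_mulVec, h, Matrix.mulVec_smul, ih, smul_smul,
        pow_succ, mul_comm]
  have h1 : HasSum (fun k : ℕ => ((k.factorial : ℂ)⁻¹ • M ^ k).mulVec v)
      ((NormedSpace.exp M).mulVec v) :=
    (NormedSpace.exp_series_hasSum_exp' (𝕂 := ℂ) M).map
      (AddMonoidHom.mk' (fun A : Matrix n n ℂ => A.mulVec v) fun A B => Matrix.add_mulVec A B v)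
      (by
        show Continuous fun A : Matrix n n ℂ => A.mulVec v
        exact Continuous.matrix_mulVec continuous_id continuous_const)
  have h2 : HasSum (fun k : ℕ => ((k.factorial : ℂ)⁻¹ • M ^ k).mulVec v) (Complex.exp μ • v) := by
    simp_rw [Matrix.smul_mulVec, hpow, smul_smul]
    rw [Complex.exp_eq_exp_ℂ]
    have := NormedSpace.exp_series_hasSum_exp' (𝕂 := ℂ) μ
    simp only [smul_eq_mul] at this
    exact this.smul_const v
  exact h1.unique h2

end Exp

/-- The Gibbs variational inequality for the probability weights `exp (-β ε j) / Z` and a doubly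
stochastic matrix `q`. -/
lemma gibbs_variational {J S : Type*} [Fintype J] [Nonempty J] [Fintype S] [Nonempty S]
    (ε : J → ℝ) (β : ℝ) (q : J → S → ℝ) (f : S → ℝ) (hq : ∀ j s, 0 ≤ q j s)
    (hrow : ∀ j, ∑ s, q j s = 1) (hcol : ∀ s, ∑ j, q j s = 1) :
    ∑ j, Real.exp (-β * ε j) / (∑ i, Real.exp (-β * ε i)) * ∑ s, q j s * f s
      + β * (∑ j, Real.exp (-β * ε j) / (∑ i, Real.exp (-β * ε i)) * ε j)
      + Real.log (∑ j, Real.exp (-β * ε j)) ≤ Real.log (∑ s, Real.exp (f s)) := by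
  set Z := ∑ i, Real.exp (-β * ε i) with hZ
  set Y := ∑ s, Real.exp (f s) with hY
  have hZ0 : 0 < Z := Finset.sum_pos (fun _ _ => Real.exp_pos _) Finset.univ_nonempty
  have hY0 : 0 < Y := Finset.sum_pos (fun _ _ => Real.exp_pos _) Finset.univ_nonempty
  have hp1 : ∑ j, Real.exp (-β * ε j) / Z = 1 := by rw [← Finset.sum_div, ← hZ, div_self hZ0.ne']
  -- This is `log x ≤ x - 1` at the ratio of the weights `exp (f s) / Y` and `exp (-β ε j) / Z`,
  -- multiplied by the joint weight; the right-hand sides sum to zero by double stochasticity.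
  have key : ∀ j s, Real.exp (-β * ε j) / Z * (q j s * (f s + β * ε j + Real.log Z - Real.log Y))
      ≤ q j s * (Real.exp (f s) / Y) - Real.exp (-β * ε j) / Z * q j s := by
    intro j s
    have hp : 0 < Real.exp (-β * ε j) / Z := by positivity
    have h1 := Real.log_le_sub_one_of_pos (x := Real.exp (f s) / Y / (Real.exp (-β * ε j) / Z))
      (by positivity)
    have h2 : Real.log (Real.exp (f s) / Y / (Real.exp (-β * ε j) / Z))
        = f s + β * ε j + Real.log Z - Real.log Y := by
      rw [Real.log_div (by positivity) hp.ne', Real.log_div (by positivity) hY0.ne',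
        Real.log_div (by positivity) hZ0.ne', Real.log_exp, Real.log_exp]
      ring
    rw [h2] at h1
    have h3 := mul_le_mul_of_nonneg_left h1 (mul_nonneg hp.le (hq j s))
    have h4 : Real.exp (-β * ε j) / Z * q j s
        * (Real.exp (f s) / Y / (Real.exp (-β * ε j) / Z) - 1)
        = q j s * (Real.exp (f s) / Y) - Real.exp (-β * ε j) / Z * q j s := by
      field_simp
    rw [h4] at h3
    linarith
  have hsum := Finset.sum_le_sum fun j (_ : j ∈ Finset.univ) =>
    Finset.sum_le_sum fun s (_ : s ∈ Finset.univ) => key j s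
  have hR : ∑ j, ∑ s, (q j s * (Real.exp (f s) / Y) - Real.exp (-β * ε j) / Z * q j s) = 0 := by
    simp_rw [Finset.sum_sub_distrib, ← Finset.mul_sum, hrow, mul_one]
    rw [hp1, Finset.sum_comm]
    simp_rw [← Finset.sum_mul, hcol, one_mul]
    rw [← Finset.sum_div, ← hY, div_self hY0.ne', sub_self]
  have hL : ∑ j, ∑ s, Real.exp (-β * ε j) / Z * (q j s * (f s + β * ε j + Real.log Z - Real.log Y))
      = ∑ j, Real.exp (-β * ε j) / Z * ∑ s, q j s * f s
        + β * (∑ j, Real.exp (-β * ε j) / Z * ε j) + Real.log Z - Real.log Y := by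
    have : ∀ j, ∑ s, Real.exp (-β * ε j) / Z * (q j s * (f s + β * ε j + Real.log Z - Real.log Y))
        = Real.exp (-β * ε j) / Z * ∑ s, q j s * f s + β * (Real.exp (-β * ε j) / Z * ε j)
          + Real.exp (-β * ε j) / Z * (Real.log Z - Real.log Y) := by
      intro j
      have h5 : ∀ s, q j s * (f s + β * ε j + Real.log Z - Real.log Y)
          = q j s * f s + q j s * (β * ε j + Real.log Z - Real.log Y) := fun s => by ring
      rw [← Finset.mul_sum]
      simp_rw [h5]
      rw [Finset.sum_add_distrib, ← Finset.sum_mul, hrow]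
      ring
    simp_rw [this]
    rw [Finset.sum_add_distrib, Finset.sum_add_distrib, ← Finset.sum_mul, hp1, ← Finset.mul_sum]
    ring
  rw [hR, hL] at hsum
  linarith

/-- The exponential moment of a weighted sum of independent signs. -/
lemma sum_exp_signs_le {X ι : Type*} [Fintype X] [DecidableEq ι] (T : Finset ι)
    (χ : ι → X → ℝ) (t : ℝ) (σ : ι → ℝ) (hσ : ∀ i, |σ i| ≤ 1) (hχ : ∀ i ∈ T, ∀ x, |χ i x| ≤ 1)
    (hflip : ∀ i ∈ T, ∃ φ : X ≃ X, (∀ x, χ i (φ x) = -χ i x) ∧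
      ∀ j ∈ T, j ≠ i → ∀ x, χ j (φ x) = χ j x) :
    ∑ x, Real.exp (∑ i ∈ T, t * (σ i * χ i x))
      ≤ Fintype.card X * Real.exp (T.card * (t ^ 2 / 2)) := by
  induction T using Finset.induction_on with
  | empty => simp
  | insert i T hi ih =>
    have ih := ih (fun j hj => hχ j (Finset.mem_insert_of_mem hj)) fun j hj => by
      obtain ⟨φ, h1, h2⟩ := hflip j (Finset.mem_insert_of_mem hj)
      exact ⟨φ, h1, fun k hk => h2 k (Finset.mem_insert_of_mem hk)⟩
    obtain ⟨φ, h1, h2⟩ := hflip i (Finset.mem_insert_self i T)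
    set g : X → ℝ := fun x => Real.exp (∑ j ∈ T, t * (σ j * χ j x)) with hg
    have hgφ : ∀ x, g (φ x) = g x := fun x => by
      simp only [hg]
      congr 1
      refine Finset.sum_congr rfl fun j hj => ?_
      rw [h2 j (Finset.mem_insert_of_mem hj) fun h => hi (h ▸ hj)]
    have hA : ∑ x, Real.exp (∑ j ∈ insert i T, t * (σ j * χ j x))
        = ∑ x, Real.exp (t * (σ i * χ i x)) * g x :=
      Finset.sum_congr rfl fun x _ => by rw [Finset.sum_insert hi, Real.exp_add]
    -- The bijection `φ` reverses `χ i` and fixes the other factors, so the exponential may be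
    -- symmetrized to a `cosh`, bounded by `exp (t ^ 2 / 2)`.
    have hB : ∑ x, Real.exp (t * (σ i * χ i x)) * g x
        = ∑ x, Real.exp (-(t * (σ i * χ i x))) * g x := by
      rw [← Equiv.sum_comp φ]
      exact Finset.sum_congr rfl fun x _ => by rw [hgφ, h1]; congr 2; ring
    have hC : ∑ x, Real.exp (t * (σ i * χ i x)) * g x
        = ∑ x, Real.cosh (t * (σ i * χ i x)) * g x := by
      have : ∀ x, Real.cosh (t * (σ i * χ i x)) * g x = (Real.exp (t * (σ i * χ i x)) * g x
          + Real.exp (-(t * (σ i * χ i x))) * g x) / 2 := fun x => by rw [Real.cosh_eq]; ring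
      simp_rw [this]
      rw [← Finset.sum_div, Finset.sum_add_distrib, ← hB]; ring
    rw [hA, hC]
    calc ∑ x, Real.cosh (t * (σ i * χ i x)) * g x ≤ ∑ x, Real.exp (t ^ 2 / 2) * g x := by
          refine Finset.sum_le_sum fun x _ => mul_le_mul_of_nonneg_right ?_ (Real.exp_pos _).le
          refine (Real.cosh_le_exp_half_sq _).trans (Real.exp_le_exp.mpr ?_)
          have h3 : |σ i * χ i x| ≤ 1 := by
            rw [abs_mul]
            exact mul_le_one₀ (hσ i) (abs_nonneg _) (hχ i (Finset.mem_insert_self i T) x)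
          have h4 : (σ i * χ i x) ^ 2 ≤ 1 := (sq_le_one_iff_abs_le_one _).mpr h3
          rw [mul_pow]
          nlinarith [sq_nonneg t]
      _ = Real.exp (t ^ 2 / 2) * ∑ x, g x := by rw [Finset.mul_sum]
      _ ≤ Real.exp (t ^ 2 / 2) * (Fintype.card X * Real.exp (T.card * (t ^ 2 / 2))) :=
          mul_le_mul_of_nonneg_left ih (Real.exp_pos _).le
      _ = Fintype.card X * Real.exp ((insert i T).card * (t ^ 2 / 2)) := by
          rw [mul_left_comm, ← Real.exp_add, Finset.card_insert_of_notMem hi]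
          congr 2; push_cast; ring

section
variable {Λ : Type} [Fintype Λ] [DecidableEq Λ]

lemma trace_eq_sum_inner {J : Type} [Fintype J] (M : Op Λ) (e : OrthonormalBasis J ℂ (Hilb Λ)) :
    M.trace = ∑ j, inner ℂ (e j) (Matrix.toEuclideanLin M (e j)) := by
  rw [← LinearMap.trace_eq_sum_inner, Matrix.toEuclideanLin, Matrix.toLpLin_eq_toLin,
    Matrix.trace_toLin_eq]

lemma toEuclideanLin_exp_apply (H : Op Λ) (β ε : ℝ) (v : Hilb Λ)
    (h : Matrix.toEuclideanLin H v = (ε : ℂ) • v) :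
    Matrix.toEuclideanLin (NormedSpace.exp (-(β : ℂ) • H)) v
      = (Real.exp (-β * ε) : ℂ) • v := by
  rw [Matrix.toLpLin_apply] at h ⊢
  have h' : H.mulVec v.ofLp = (ε : ℂ) • v.ofLp := congrArg WithLp.ofLp h
  rw [exp_mulVec_of_eigenvector (-(β : ℂ) • H) v.ofLp (-(β : ℂ) * ε)
    (by rw [Matrix.smul_mulVec, h', smul_smul])]
  push_cast
  rfl

section Thermal
variable {J : Type} [Fintype J] (H : Op Λ) (e : OrthonormalBasis J ℂ (Hilb Λ)) (ε : J → ℝ)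

lemma trace_exp (he : ∀ j, Matrix.toEuclideanLin H (e j) = (ε j : ℂ) • e j) (β : ℝ) :
    (NormedSpace.exp (-(β : ℂ) • H)).trace = ((∑ j, Real.exp (-β * ε j) : ℝ) : ℂ) := by
  rw [trace_eq_sum_inner _ e, Complex.ofReal_sum]
  refine Finset.sum_congr rfl fun j _ => ?_
  rw [toEuclideanLin_exp_apply H β (ε j) _ (he j), inner_smul_right,
    inner_self_eq_norm_sq_to_K, e.norm_eq_one]
  simp

lemma thermalEnergy_eq (he : ∀ j, Matrix.toEuclideanLin H (e j) = (ε j : ℂ) • e j) (β : ℝ) :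
    thermalEnergy H β
      = ∑ j, Real.exp (-β * ε j) / (∑ i, Real.exp (-β * ε i)) * ε j := by
  have h1 : (NormedSpace.exp (-(β : ℂ) • H) * H).trace
      = ((∑ j, Real.exp (-β * ε j) * ε j : ℝ) : ℂ) := by
    rw [trace_eq_sum_inner _ e, Complex.ofReal_sum]
    refine Finset.sum_congr rfl fun j _ => ?_
    have : Matrix.toEuclideanLin (NormedSpace.exp (-(β : ℂ) • H) * H) (e j)
        = Matrix.toEuclideanLin (NormedSpace.exp (-(β : ℂ) • H))
            (Matrix.toEuclideanLin H (e j)) := by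
      simp only [Matrix.toLpLin_apply, Matrix.mulVec_mulVec]
    rw [this, he, map_smul, toEuclideanLin_exp_apply H β (ε j) _ (he j), smul_smul,
      inner_smul_right, inner_self_eq_norm_sq_to_K, e.norm_eq_one]
    push_cast
    ring
  rw [thermalEnergy, gibbs, smul_mul_assoc, Matrix.trace_smul, h1, trace_exp H e ε he,
    smul_eq_mul, ← Complex.ofReal_inv, ← Complex.ofReal_mul, Complex.ofReal_re, Finset.mul_sum]
  exact Finset.sum_congr rfl fun j _ => by rw [div_eq_mul_inv]; ring

end Thermal

/-- A string whose letters match the axes `k` is diagonal in the corresponding product basis, so its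
expectation is classical. -/
lemma inner_pauliOp_eq_sum (P : PauliString Λ) (k : Λ → Axis)
    (v : OrthonormalBasis (Λ → Bool) ℂ (Hilb Λ))
    (hv : ∀ s, v s = productState fun i => (k i, s i)) (hP : ∀ i, P i = none ∨ P i = some (k i))
    (x : Hilb Λ) :
    (inner ℂ x (Matrix.toEuclideanLin (pauliOp P) x)).re
      = ∑ s, ‖(inner ℂ (v s) x : ℂ)‖ ^ 2 * pauliChar P (fun i => (k i, s i)) := by
  have h1 : Matrix.toEuclideanLin (pauliOp P) x
      = ∑ s, inner ℂ (v s) x • ((pauliChar P (fun i => (k i, s i)) : ℂ) • v s) := by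
    conv_lhs => rw [← v.sum_repr' x]
    rw [map_sum]
    refine Finset.sum_congr rfl fun s _ => ?_
    rw [map_smul, hv, pauliOp_productState P _ hP]
  rw [h1, inner_sum, Complex.re_sum]
  refine Finset.sum_congr rfl fun s _ => ?_
  rw [inner_smul_right, inner_smul_right, mul_left_comm, ← inner_conj_symm x (v s),
    Complex.mul_conj', mul_comm]
  norm_cast

lemma pauliChar_flip (P : PauliString Λ) (k : Λ → Axis) (i : Λ) (s : Λ → Bool) :
    pauliChar P (fun j => (k j, Function.update s i (!s i) j))
      = if i ∈ supp P then -pauliChar P (fun j => (k j, s j))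
        else pauliChar P (fun j => (k j, s j)) := by
  have hrest : ∏ j ∈ Finset.univ.erase i, siteChar (P j) (k j, Function.update s i (!s i) j)
      = ∏ j ∈ Finset.univ.erase i, siteChar (P j) (k j, s j) :=
    Finset.prod_congr rfl fun j hj => by
      rw [Function.update_of_ne (Finset.ne_of_mem_erase hj)]
  rw [pauliChar, pauliChar, ← Finset.mul_prod_erase _ _ (Finset.mem_univ i), hrest,
    ← Finset.mul_prod_erase Finset.univ (fun j => siteChar (P j) (k j, s j)) (Finset.mem_univ i)]
  simp only [Function.update_self, mem_supp]
  rcases hP : P i with _ | o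
  · simp [siteChar]
  · cases s i <;> by_cases h : o = k i <;> simp [siteChar, h]

/-- The flip of the qubit at `i`. -/
def flipAt (i : Λ) : (Λ → Bool) ≃ (Λ → Bool) :=
  Function.Involutive.toPerm (fun s => Function.update s i (!s i)) fun s => by simp

namespace IsSparse
variable {c : PauliString Λ → ℝ} {V D : ℕ} {a b : ℝ}

/-- The variational inequality with trial exponent `t ∑ σ P χ P`, the signs `σ` matching the thermal
expectations. The `N log 2` in the trial partition function cancels against the lower bound on `log
Z`. -/
lemma sum_abs_thermal_pauli_le (h : IsSparse c V D a b) {J : Type} [Fintype J]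
    (e : OrthonormalBasis J ℂ (Hilb Λ)) (ε : J → ℝ)
    (he : ∀ j, Matrix.toEuclideanLin (hamiltonian c) (e j) = (ε j : ℂ) • e j) (β t : ℝ)
    (T : Finset (PauliString Λ)) (hT : T ⊆ terms c)
    (hfree : ∀ P ∈ T, ∀ P' ∈ T, P ≠ P' → ¬ Conflict c P P') :
    t * ∑ P ∈ T, |∑ j, Real.exp (-β * ε j) / (∑ i, Real.exp (-β * ε i)) *
        (inner ℂ (e j) (Matrix.toEuclideanLin (pauliOp P) (e j))).re|
      ≤ T.card * (t ^ 2 / 2) - β * thermalEnergy (hamiltonian c) β := by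
  classical
  have hJ : Fintype.card J = 2 ^ Fintype.card Λ := by
    rw [← finrank_hilb (Λ := Λ), Module.finrank_eq_card_basis e.toBasis]
  have : Nonempty J := Fintype.card_pos_iff.mp (by rw [hJ]; positivity)
  set p : J → ℝ := fun j => Real.exp (-β * ε j) / (∑ i, Real.exp (-β * ε i)) with hp
  set w : PauliString Λ → ℝ := fun P =>
    ∑ j, p j * (inner ℂ (e j) (Matrix.toEuclideanLin (pauliOp P) (e j))).re with hw
  have hdis : ∀ P ∈ T, ∀ P' ∈ T, ∀ i ∈ supp P, i ∈ supp P' → P = P' := by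
    intro P hP P' hP' i hi hi'
    by_contra hne
    exact hfree P hP P' hP' hne ⟨P, hT hP, ⟨i, hi, hi⟩, ⟨i, hi', hi⟩⟩
  -- The supports in `T` are disjoint, so one axis per site diagonalizes all of `T` at once;
  -- untouched sites get `.z`.
  obtain ⟨k, hk⟩ : ∃ k : Λ → Axis, ∀ P ∈ T, ∀ i, P i = none ∨ P i = some (k i) := by
    have : ∀ i, ∃ k : Axis, ∀ P ∈ T, P i = none ∨ P i = some k := by
      intro i
      by_cases hi : ∃ P ∈ T, i ∈ supp P
      · obtain ⟨P, hP, hi⟩ := hi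
        obtain ⟨k, hk⟩ := Option.ne_none_iff_exists'.mp (mem_supp.mp hi)
        refine ⟨k, fun P' hP' => ?_⟩
        by_cases hi' : P' i = none
        · exact Or.inl hi'
        · right
          rw [← hdis P hP P' hP' i hi (mem_supp.mpr hi'), hk]
      · push Not at hi
        exact ⟨.z, fun P hP => Or.inl (by simpa [mem_supp] using hi P hP)⟩
    choose k hk using this
    exact ⟨k, fun P hP i => hk i P hP⟩
  obtain ⟨v, hv⟩ := exists_product_basis k
  obtain ⟨σ, hσ1, hσ⟩ : ∃ σ : PauliString Λ → ℝ, (∀ P, |σ P| ≤ 1) ∧ ∀ P, σ P * w P = |w P| := by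
    have : ∀ P, ∃ s : ℝ, |s| ≤ 1 ∧ s * w P = |w P| := fun P => by
      rcases le_total 0 (w P) with h0 | h0
      · exact ⟨1, by simp, by rw [abs_of_nonneg h0, one_mul]⟩
      · exact ⟨-1, by simp, by rw [abs_of_nonpos h0, neg_one_mul]⟩
    choose σ h1 h2 using this
    exact ⟨σ, h1, h2⟩
  set χ : PauliString Λ → (Λ → Bool) → ℝ := fun P s => pauliChar P fun i => (k i, s i) with hχ
  have hgibbs := gibbs_variational ε β (fun j s => ‖(inner ℂ (v s) (e j) : ℂ)‖ ^ 2)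
    (fun s => ∑ P ∈ T, t * (σ P * χ P s)) (fun _ _ => by positivity)
    (fun j => by rw [v.sum_sq_norm_inner_right, e.norm_eq_one, one_pow])
    (fun s => by
      simp_rw [norm_inner_symm (v s)]
      rw [e.sum_sq_norm_inner_right, v.norm_eq_one, one_pow])
  rw [← thermalEnergy_eq (hamiltonian c) e ε he] at hgibbs
  have hmean : ∑ j, p j * ∑ s, ‖(inner ℂ (v s) (e j) : ℂ)‖ ^ 2 * ∑ P ∈ T, t * (σ P * χ P s)
      = t * ∑ P ∈ T, |w P| := by
    have h1 : ∀ j, ∑ s, ‖(inner ℂ (v s) (e j) : ℂ)‖ ^ 2 * ∑ P ∈ T, t * (σ P * χ P s)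
        = ∑ P ∈ T, t * (σ P * (inner ℂ (e j) (Matrix.toEuclideanLin (pauliOp P) (e j))).re) := by
      intro j
      simp_rw [Finset.mul_sum]
      rw [Finset.sum_comm]
      refine Finset.sum_congr rfl fun P hP => ?_
      rw [inner_pauliOp_eq_sum P k v hv (hk P hP), Finset.mul_sum, Finset.mul_sum]
      exact Finset.sum_congr rfl fun s _ => by ring
    simp_rw [h1, Finset.mul_sum]
    rw [Finset.sum_comm]
    refine Finset.sum_congr rfl fun P _ => ?_
    rw [← hσ, hw, Finset.mul_sum, Finset.mul_sum]
    exact Finset.sum_congr rfl fun j _ => by ring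
  have hY : Real.log (∑ s, Real.exp (∑ P ∈ T, t * (σ P * χ P s)))
      ≤ Fintype.card Λ * Real.log 2 + T.card * (t ^ 2 / 2) := by
    have h1 := sum_exp_signs_le T χ t σ hσ1 (fun P _ s => abs_pauliChar_le P _) fun P hP => by
      obtain ⟨i, hi⟩ := h.exists_mem_supp (mem_terms.mp (hT hP))
      -- Flipping a qubit in the support of `P` reverses `χ P` and, by disjointness, no other `χ
      -- P'`.
      refine ⟨flipAt i, fun s => ?_, fun P' hP' hne s => ?_⟩
      · exact (pauliChar_flip P k i s).trans (if_pos hi)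
      · exact (pauliChar_flip P' k i s).trans
          (if_neg fun hi' => hne (hdis P hP P' hP' i hi hi').symm)
    refine (Real.log_le_log (Finset.sum_pos (fun _ _ => Real.exp_pos _)
      Finset.univ_nonempty) h1).trans (le_of_eq ?_)
    rw [Real.log_mul (by positivity) (Real.exp_ne_zero _), Real.log_exp, Fintype.card_fun,
      Fintype.card_bool]
    push_cast
    rw [Real.log_pow]
  -- Tracelessness and `1 + x ≤ exp x` give `Z ≥ 2 ^ N`.
  have hZ : Fintype.card Λ * Real.log 2 ≤ Real.log (∑ j, Real.exp (-β * ε j)) := by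
    rw [← Real.log_pow]
    refine Real.log_le_log (by positivity) ?_
    have hε : ∑ j, ε j = 0 := by
      have h1 := trace_eq_sum_inner (hamiltonian c) e
      rw [trace_hamiltonian h.traceless] at h1
      have h2 : ∀ j, inner ℂ (e j) (Matrix.toEuclideanLin (hamiltonian c) (e j)) = (ε j : ℂ) :=
        fun j => by
          rw [he, inner_smul_right, inner_self_eq_norm_sq_to_K, e.norm_eq_one]; simp
      simp_rw [h2] at h1
      exact_mod_cast h1.symm
    have h3 : ∑ j, (-β * ε j + 1) ≤ ∑ j, Real.exp (-β * ε j) :=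
      Finset.sum_le_sum fun j _ => Real.add_one_le_exp _
    rw [Finset.sum_add_distrib, ← Finset.mul_sum, hε, mul_zero, zero_add, Finset.sum_const,
      Finset.card_univ, hJ] at h3
    simpa using h3
  rw [hmean] at hgibbs
  linarith

/-- At high temperature the energy density of the thermal state is small. -/
lemma abs_thermalEnergy_le (h : IsSparse c V D a b) {J : Type} [Fintype J]
    (e : OrthonormalBasis J ℂ (Hilb Λ)) (he : IsEigenbasis (hamiltonian c) e) {β t : ℝ}
    (ht : 0 < t) (hβ : |β| * (b * (V * D * (V * D) : ℕ)) ≤ t / 2) :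
    |thermalEnergy (hamiltonian c) β|
      ≤ b * (V * D * (V * D) : ℕ) * (t * (Fintype.card Λ * D)) := by
  choose ε hε using he
  set p : J → ℝ := fun j => Real.exp (-β * ε j) / (∑ i, Real.exp (-β * ε i)) with hp
  set w : PauliString Λ → ℝ := fun P =>
    ∑ j, p j * (inner ℂ (e j) (Matrix.toEuclideanLin (pauliOp P) (e j))).re with hw
  obtain ⟨T, hT, hfree, hsum⟩ := h.exists_conflict_free (fun P => |w P|) fun P => abs_nonneg _
  set M : ℝ := ((V * D * (V * D) : ℕ) : ℝ) with hM
  set W := ∑ P ∈ T, |w P| with hW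
  have hE : thermalEnergy (hamiltonian c) β = ∑ P, c P * w P := by
    rw [thermalEnergy_eq _ e ε hε]
    have h1 : ∀ j, ε j = ∑ P, c P *
        (inner ℂ (e j) (Matrix.toEuclideanLin (pauliOp P) (e j))).re := fun j => by
      have h2 := inner_hamiltonian c (e j)
      rw [hε, inner_smul_right, inner_self_eq_norm_sq_to_K, e.norm_eq_one] at h2
      have h3 := congrArg Complex.re h2
      rw [Complex.re_sum] at h3
      simpa using h3
    refine (Finset.sum_congr rfl fun j _ => congrArg (p j * ·) (h1 j)).trans ?_
    simp_rw [hw, Finset.mul_sum]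
    rw [Finset.sum_comm]
    exact Finset.sum_congr rfl fun P _ => Finset.sum_congr rfl fun j _ => by ring
  have hEW : |thermalEnergy (hamiltonian c) β| ≤ b * (M * W) := by
    rw [hE]
    refine (Finset.abs_sum_le_sum_abs _ _).trans ?_
    rw [← Finset.sum_subset (Finset.subset_univ (terms c)) fun P _ hP => by
      rw [show c P = 0 by simpa [mem_terms] using hP, zero_mul, abs_zero]]
    refine le_trans ?_ (mul_le_mul_of_nonneg_left hsum h.nonneg)
    rw [Finset.mul_sum]
    refine Finset.sum_le_sum fun P _ => ?_
    rw [abs_mul]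
    exact mul_le_mul_of_nonneg_right (h.abs_le P) (abs_nonneg _)
  have hkey := h.sum_abs_thermal_pauli_le e ε hε β t T hT hfree
  change t * W ≤ _ at hkey
  have hW0 : 0 ≤ W := Finset.sum_nonneg fun _ _ => abs_nonneg _
  -- The energy is itself controlled by `W`, so for small `|β|` half of `t * W` absorbs it, leaving
  -- `W ≤ t * T.card`.
  have h1 : -(β * thermalEnergy (hamiltonian c) β) ≤ t / 2 * W := by
    refine (neg_le_abs _).trans ?_
    rw [abs_mul]
    calc |β| * |thermalEnergy (hamiltonian c) β| ≤ |β| * (b * (M * W)) :=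
          mul_le_mul_of_nonneg_left hEW (abs_nonneg _)
      _ = |β| * (b * M) * W := by ring
      _ ≤ t / 2 * W := mul_le_mul_of_nonneg_right hβ hW0
  have h2 : W ≤ t * T.card := by
    have : t * W ≤ t * (t * T.card) := by nlinarith
    exact le_of_mul_le_mul_left this ht
  have h3 : (T.card : ℝ) ≤ Fintype.card Λ * D := by
    exact_mod_cast (Finset.card_le_card hT).trans h.card_terms_le
  have hM0 : 0 ≤ M := Nat.cast_nonneg _
  calc |thermalEnergy (hamiltonian c) β| ≤ b * M * W := by rw [mul_assoc]; exact hEW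
    _ ≤ b * M * (t * (Fintype.card Λ * D)) :=
      mul_le_mul_of_nonneg_left (h2.trans (mul_le_mul_of_nonneg_left h3 ht.le))
        (mul_nonneg h.nonneg hM0)

end IsSparse
end

/-! ### Lattice geometry: sparsity and the number of terms. -/

section Geometry
variable {d r : ℕ} {L : Fin d → ℕ}

lemma card_coordDist_le (bc : Boundary) (ℓ r : ℕ) (p : Fin ℓ) :
    (Finset.univ.filter fun q => coordDist bc ℓ p q ≤ r).card ≤ 4 * r + 1 := by
  -- The interval around `p` has at most `2 r + 1` points; wrapping around adds at most `r` at each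
  -- end of the side.
  have hsub : (Finset.univ.filter fun q => coordDist bc ℓ p q ≤ r).card ≤
      (Finset.Icc (p - r : ℕ) (p + r) ∪ (Finset.range r ∪ Finset.Ico (ℓ - r) ℓ)).card := by
    refine Finset.card_le_card_of_injOn (fun q => (q : ℕ)) ?_ (Fin.val_injective.injOn)
    intro q hq
    have hq' : coordDist bc ℓ p q ≤ r := by simpa using hq
    have hqlt := q.isLt
    simp only [Finset.coe_union, Set.mem_union, Finset.mem_coe, Finset.mem_Icc, Finset.mem_range,
      Finset.mem_Ico]
    cases bc <;> simp only [coordDist, Nat.dist] at hq' <;> omega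
  refine hsub.trans ((Finset.card_union_le _ _).trans ?_)
  have h1 := Finset.card_union_le (Finset.range r) (Finset.Ico (ℓ - r) ℓ)
  simp only [Nat.card_Icc, Finset.card_range, Nat.card_Ico] at h1 ⊢
  omega

lemma card_siteDist_le (bc : Boundary) (r : ℕ) (u : Site L) :
    (Finset.univ.filter fun v => siteDist bc u v ≤ r).card ≤ (4 * r + 1) ^ d := by
  have hsub : (Finset.univ.filter fun v => siteDist bc u v ≤ r) ⊆
      Fintype.piFinset fun k => Finset.univ.filter fun q => coordDist bc (L k) (u k) q ≤ r := by
    intro v hv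
    rw [Finset.mem_filter, siteDist, Finset.sup_le_iff] at hv
    simpa using hv.2
  refine (Finset.card_le_card hsub).trans ?_
  rw [Fintype.card_piFinset]
  refine (Finset.prod_le_prod' fun k _ => card_coordDist_le bc (L k) r (u k)).trans ?_
  simp

lemma card_supp_subset {Λ : Type} [Fintype Λ] [DecidableEq Λ] (B : Finset Λ) :
    (Finset.univ.filter fun P : PauliString Λ => supp P ⊆ B).card ≤ 4 ^ B.card := by
  have hc : 4 ^ B.card = Fintype.card (B → Option Axis) := by simp [card_axis]
  rw [hc, ← Finset.card_univ]
  refine Finset.card_le_card_of_injOn (fun P i => P i) (fun _ _ => by simp) ?_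
  intro P hP Q hQ hPQ
  have hP' : supp P ⊆ B := by simpa using hP
  have hQ' : supp Q ⊆ B := by simpa using hQ
  funext i
  by_cases hi : i ∈ B
  · exact congrFun hPQ ⟨i, hi⟩
  · have h1 : P i = none := by by_contra h; exact hi (hP' (mem_supp.mpr h))
    have h2 : Q i = none := by by_contra h; exact hi (hQ' (mem_supp.mpr h))
    rw [h1, h2]

/-- A term at `u` lives in the ball of radius `r` about `u`, which bounds both its support and the
number of such terms. Taking `max a b` keeps the coefficient bound positive even when there is no
term. -/
lemma IsLocalExtensive.isSparse {bc : Boundary} {a b : ℝ} (ha : 0 < a)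
    {c : PauliString (Site L) → ℝ} (h : IsLocalExtensive bc r a b c) :
    IsSparse c ((4 * r + 1) ^ d) (4 ^ (4 * r + 1) ^ d) a (max a b) where
  traceless := h.traceless
  card_supp_le P hP := by
    rcases (supp P).eq_empty_or_nonempty with he | ⟨u, hu⟩
    · rw [he]; exact Nat.zero_le _
    · exact (Finset.card_le_card fun v hv =>
        Finset.mem_filter.mpr ⟨Finset.mem_univ v, h.isLocal P hP u hu v hv⟩).trans
          (card_siteDist_le bc r u)
  card_termsAt_le u := by
    refine (Finset.card_le_card fun P hP => ?_).trans
      ((card_supp_subset (Finset.univ.filter fun v => siteDist bc u v ≤ r)).trans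
        (Nat.pow_le_pow_right (by norm_num) (card_siteDist_le bc r u)))
    obtain ⟨hP, hu⟩ := mem_termsAt.mp hP
    exact Finset.mem_filter.mpr ⟨Finset.mem_univ P, fun v hv =>
      Finset.mem_filter.mpr ⟨Finset.mem_univ v, h.isLocal P hP u hu v hv⟩⟩
  le_abs P hP := (h.bounded P hP).1
  abs_le P := by
    by_cases hP : c P = 0
    · rw [hP, abs_zero]; exact ha.le.trans (le_max_left _ _)
    · exact (h.bounded P hP).2.trans (le_max_right _ _)

lemma IsLocalExtensive.prod_le_card_terms {bc : Boundary} {a b : ℝ}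
    {c : PauliString (Site L) → ℝ} (h : IsLocalExtensive bc r a b c) (hL : ∀ k, r < L k) :
    ∏ k, L k ≤ (r + 1) ^ d * ((r + 1) ^ d * (terms c).card) := by
  let corners : Finset (Site L) :=
    Fintype.piFinset fun k => Finset.univ.filter fun q : Fin (L k) => (q : ℕ) + r < L k
  have hmem : ∀ u ∈ corners, ∀ k, (u k : ℕ) + r < L k := fun u hu k => by
    simpa using Fintype.mem_piFinset.mp hu k
  have hcorners : ∏ k, L k ≤ (r + 1) ^ d * corners.card := by
    -- A side longer than `r` has `L k - r` admissible corners, and `r + m + 1 ≤ (r + 1) * (m + 1)`.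
    have h1 : ∀ k, L k ≤ (r + 1) *
        (Finset.univ.filter fun q : Fin (L k) => (q : ℕ) + r < L k).card := by
      intro k
      have h2 : L k - r ≤ (Finset.univ.filter fun q : Fin (L k) => (q : ℕ) + r < L k).card := by
        rw [← Finset.card_range (L k - r)]
        refine Finset.card_le_card_of_surjOn (fun q : Fin (L k) => (q : ℕ)) fun n hn => ?_
        have hn' : n < L k - r := by simpa using hn
        exact ⟨⟨n, by omega⟩, by simp; omega, rfl⟩
      refine le_trans ?_ (Nat.mul_le_mul_left _ h2)
      obtain ⟨m, hm⟩ := Nat.exists_eq_add_of_lt (hL k)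
      rw [hm, show r + m + 1 - r = m + 1 by omega]
      nlinarith
    refine (Finset.prod_le_prod' fun k _ => h1 k).trans ?_
    rw [Finset.prod_mul_distrib, Fintype.card_piFinset]
    simp
  refine hcorners.trans (Nat.mul_le_mul_left _ ?_)
  have hex : ∀ u : Site L, ∃ P, u ∈ corners → c P ≠ 0 ∧
      ∀ v ∈ supp P, ∀ k, (u k : ℕ) ≤ v k ∧ (v k : ℕ) ≤ u k + r := fun u => by
    by_cases hu : u ∈ corners
    · obtain ⟨P, hP⟩ := h.isExtensive u (hmem u hu)
      exact ⟨P, fun _ => hP⟩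
    · exact ⟨fun _ => none, fun hu' => absurd hu' hu⟩
  choose f hf using hex
  refine Finset.card_le_mul_card_image_of_maps_to (f := f)
    (fun u hu => mem_terms.mpr (hf u hu).1) _ fun P hP => ?_
  obtain ⟨v, hv⟩ : ∃ v, v ∈ supp P := by
    by_contra! hc
    refine mem_terms.mp hP ?_
    rw [show P = fun _ => none from funext fun i => by simpa [mem_supp] using hc i, h.traceless]
  -- A term is chosen by few regions: a corner `u` whose region contains `v` has only `r + 1`
  -- possible values per coordinate.
  have hsub : corners.filter (fun u => f u = P) ⊆ Fintype.piFinset fun k =>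
      Finset.univ.filter fun q : Fin (L k) => (q : ℕ) ≤ v k ∧ (v k : ℕ) ≤ q + r := by
    intro u hu
    obtain ⟨hu', rfl⟩ := Finset.mem_filter.mp hu
    simpa using (hf u hu').2 v hv
  refine (Finset.card_le_card hsub).trans ?_
  rw [Fintype.card_piFinset]
  have h1 : ∀ k, (Finset.univ.filter fun q : Fin (L k) =>
      (q : ℕ) ≤ v k ∧ (v k : ℕ) ≤ q + r).card ≤ r + 1 := fun k => by
    refine (Finset.card_le_card_of_injOn (t := Finset.Icc ((v k : ℕ) - r) (v k))
      (fun q : Fin (L k) => (q : ℕ)) ?_ Fin.val_injective.injOn).trans ?_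
    · intro q hq
      have hq' : (q : ℕ) ≤ v k ∧ (v k : ℕ) ≤ q + r := by simpa using hq
      simp only [Finset.coe_Icc, Set.mem_Icc]
      omega
    · rw [Nat.card_Icc]; omega
  refine (Finset.prod_le_prod' fun k _ => h1 k).trans ?_
  simp

end Geometry

/-! ### The size of the energy shell. -/

section
variable {Λ : Type} [Fintype Λ] [DecidableEq Λ]

lemma shell_eq (c : PauliString Λ → ℝ) (β δ : ℝ) :
    shell (hamiltonian c) β δ = Finset.univ.filter fun ψ =>
      |productEnergy c ψ - thermalEnergy (hamiltonian c) β| ≤ δ := by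
  ext ψ
  rw [shell, Finset.mem_filter, Finset.mem_filter, energy_productState]
  rfl

/-- The energy shell around a thermal energy of small density contains a large fraction of the
product states. -/
lemma IsSparse.card_shell_ge {c : PauliString Λ → ℝ} {V D G : ℕ} {a b κ β δ : ℝ}
    (h : IsSparse c V D a b) (ha : 0 < a) (hb : 0 < b) (hD : 0 < D)
    (hterms : Fintype.card Λ ≤ G * (terms c).card) (hκ : 0 < κ)
    (hκM : κ * (G * (V * D * (V * D) : ℕ)) ≤ 1) (hκV : 20 * κ * V ≤ 1)
    (hN : 2 ≤ κ * Fintype.card Λ)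
    (hE : |thermalEnergy (hamiltonian c) β| ≤ κ * (a * (1 / 3) ^ V) / 8 * Fintype.card Λ)
    (hδ : 2 * b * D ≤ δ) :
    ∃ m : ℕ, 20 * m ≤ Fintype.card Λ ∧
      (κ * (a * (1 / 3) ^ V) / (4 * (b * D))) ^ 2 * 6 ^ Fintype.card Λ ≤
        6 ^ (2 * m) * (Fintype.card Λ * (shell (hamiltonian c) β δ).card) := by
  set N := Fintype.card Λ with hNdef
  set s := a * (1 / 3 : ℝ) ^ V with hs
  set E := thermalEnergy (hamiltonian c) β with hEdef
  have hs0 : 0 < s := by positivity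
  have hN0 : (0 : ℝ) < N := by
    by_contra hc
    have : κ * (N : ℝ) ≤ 0 := mul_nonpos_of_nonneg_of_nonpos hκ.le (not_lt.mp hc)
    linarith
  obtain ⟨T₀, hT₀, hfree₀, hcard₀⟩ := h.exists_conflict_free (fun _ => 1) fun _ => zero_le_one
  have hfloor : ⌊κ * N⌋₊ ≤ T₀.card := by
    rw [← Nat.cast_le (α := ℝ)]
    refine (Nat.floor_le (by positivity)).trans ?_
    simp only [Finset.sum_const, nsmul_eq_mul, mul_one] at hcard₀
    have h1 : (N : ℝ) ≤ G * (terms c).card := by exact_mod_cast hterms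
    calc κ * N ≤ κ * (G * ((V * D * (V * D) : ℕ) * T₀.card)) :=
          mul_le_mul_of_nonneg_left (h1.trans (mul_le_mul_of_nonneg_left hcard₀
            (Nat.cast_nonneg _))) hκ.le
      _ = κ * (G * (V * D * (V * D) : ℕ)) * T₀.card := by ring
      _ ≤ T₀.card := mul_le_of_le_one_left (Nat.cast_nonneg _) hκM
  -- Trimming to `⌊κ N⌋` terms keeps the number of fixed sites below `N / 20` while the energy gain
  -- stays extensive.
  obtain ⟨T, hTT₀, hTcard⟩ := Finset.exists_subset_card_eq hfloor
  have hT : T ⊆ terms c := hTT₀.trans hT₀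
  have hfree : ∀ P ∈ T, ∀ P' ∈ T, P ≠ P' → ¬ Conflict c P P' := fun P hP P' hP' =>
    hfree₀ P (hTT₀ hP) P' (hTT₀ hP')
  have hTle : (T.card : ℝ) ≤ κ * N := by rw [hTcard]; exact Nat.floor_le (by positivity)
  have hTge : κ * N / 2 ≤ T.card := by
    rw [hTcard]; have := Nat.lt_floor_add_one (κ * N); linarith
  have hup := h.card_productEnergy_ge ha T hT hfree
  -- Low-energy states are high-energy states of `-c`, which has the same terms and conflicts.
  have hdown := h.neg.card_productEnergy_ge ha T (by rwa [terms_neg]) fun P hP P' hP' hne hc =>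
    hfree P hP P' hP' hne (by simpa only [Conflict, terms_neg] using hc)
  have hEabs := _root_.abs_le.mp hE
  -- The levels `± T.card * s / 2` are at least twice as far from zero as `hE` allows `E` to be.
  have hlevel : κ * s / 4 * N ≤ T.card * s / 2 := by nlinarith
  have hsN : 0 < κ * s * N := by positivity
  set m := T.card * V with hm
  set ρ := κ * s / (4 * (b * D)) with hρ
  have hD' : (0 : ℝ) < D := by exact_mod_cast hD
  have hbD : 0 < b * D := mul_pos hb hD'
  have hρ0 : 0 < ρ := by positivity
  have hlarge : ∀ A B : Finset (ProductLabel Λ), B ⊆ A →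
      T.card * s / 2 * 6 ^ N ≤ B.card * 6 ^ m * (b * D * N) →
      ρ * 6 ^ N ≤ A.card * 6 ^ m := by
    intro A B hBA hB
    have h1 : (B.card : ℝ) ≤ A.card := by exact_mod_cast Finset.card_le_card hBA
    have h2 : ρ * 6 ^ N * (b * D * N) ≤ A.card * 6 ^ m * (b * D * N) := by
      calc ρ * 6 ^ N * (b * D * N) = κ * s / 4 * N * 6 ^ N := by rw [hρ]; field_simp
        _ ≤ T.card * s / 2 * 6 ^ N := mul_le_mul_of_nonneg_right hlevel (by positivity)
        _ ≤ B.card * 6 ^ m * (b * D * N) := hB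
        _ ≤ A.card * 6 ^ m * (b * D * N) := by gcongr
    exact le_of_mul_le_mul_right h2 (by positivity)
  have hA := hlarge (Finset.univ.filter fun ψ => E ≤ productEnergy c ψ) _ (fun ψ hψ => by
    have h1 := (Finset.mem_filter.mp hψ).2
    refine Finset.mem_filter.mpr ⟨Finset.mem_univ ψ, ?_⟩
    linarith) hup
  have hB := hlarge (Finset.univ.filter fun ψ => productEnergy c ψ < E) _ (fun ψ hψ => by
    have h1 := (Finset.mem_filter.mp hψ).2
    have h2 : productEnergy (-c) ψ = -productEnergy c ψ := by simp [productEnergy]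
    rw [h2] at h1
    refine Finset.mem_filter.mpr ⟨Finset.mem_univ ψ, ?_⟩
    linarith) hdown
  have hcross := card_mul_card_le_card_shell (productEnergy c) (2 * b * D) E
    fun x y i hxy => h.productEnergy_sub_le x y i hxy
  rw [card_productLabel] at hcross
  have hshell : (Finset.univ.filter fun ψ => |productEnergy c ψ - E| ≤ 2 * b * D).card
      ≤ (shell (hamiltonian c) β δ).card := by
    rw [shell_eq]
    exact Finset.card_le_card fun ψ hψ => Finset.mem_filter.mpr
      ⟨Finset.mem_univ ψ, (Finset.mem_filter.mp hψ).2.trans hδ⟩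
  have hcross' : ((Finset.univ.filter fun ψ => E ≤ productEnergy c ψ).card : ℝ) *
      (Finset.univ.filter fun ψ => productEnergy c ψ < E).card ≤
      N * ((shell (hamiltonian c) β δ).card * 6 ^ N) := by
    exact_mod_cast hcross.trans (Nat.mul_le_mul_left _ (Nat.mul_le_mul_right _ hshell))
  refine ⟨m, ?_, ?_⟩
  · have : (20 * m : ℝ) ≤ N := by
      rw [hm]; push_cast
      calc 20 * ((T.card : ℝ) * V) ≤ 20 * (κ * N * V) := by gcongr
        _ = 20 * κ * V * N := by ring
        _ ≤ N := mul_le_of_le_one_left hN0.le hκV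
    exact_mod_cast this
  · have h6 : (0 : ℝ) < 6 ^ N := by positivity
    refine le_of_mul_le_mul_right ?_ h6
    calc ρ ^ 2 * 6 ^ N * 6 ^ N = (ρ * 6 ^ N) * (ρ * 6 ^ N) := by ring
      _ ≤ ((Finset.univ.filter fun ψ => E ≤ productEnergy c ψ).card * 6 ^ m) *
          ((Finset.univ.filter fun ψ => productEnergy c ψ < E).card * 6 ^ m) :=
        mul_le_mul hA hB (by positivity) (by positivity)
      _ = 6 ^ (2 * m) * (((Finset.univ.filter fun ψ => E ≤ productEnergy c ψ).card : ℝ) *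
          (Finset.univ.filter fun ψ => productEnergy c ψ < E).card) := by ring
      _ ≤ 6 ^ (2 * m) * (N * ((shell (hamiltonian c) β δ).card * 6 ^ N)) :=
        mul_le_mul_of_nonneg_left hcross' (by positivity)
      _ = 6 ^ (2 * m) * (N * (shell (hamiltonian c) β δ).card) * 6 ^ N := by ring

end

/-! ### Numerical margin and Markov's inequality. -/

/-- The gain `(2/3) ^ N` beats the loss `6 ^ (2 m) ≤ 6 ^ (N / 10)`. In tenth powers the claim per
site is `exp 2 ≤ (3/2) ^ 10 / 6`, which is about `9.6`. -/
lemma four_pow_mul_six_pow_le {m N : ℕ} (h : 20 * m ≤ N) :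
    (4 : ℝ) ^ N * 6 ^ (2 * m) ≤ 6 ^ N * Real.exp (-(1 / 5)) ^ N := by
  rw [← pow_le_pow_iff_left₀ (by positivity) (by positivity) (n := 10) (by norm_num)]
  have he : (6 * 4 ^ 10 : ℝ) ≤ 6 ^ 10 * Real.exp (-(1 / 5)) ^ 10 := by
    have h1 : Real.exp (-(1 / 5)) ^ 10 * Real.exp 1 ^ 2 = 1 := by
      rw [← Real.exp_nat_mul, ← Real.exp_nat_mul, ← Real.exp_add]; norm_num
    have h2 : Real.exp 1 ^ 2 ≤ 7.4 := by
      have := Real.exp_one_lt_d9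
      nlinarith [Real.exp_pos 1]
    have h3 : 0 < Real.exp (-(1 / 5)) ^ 10 := by positivity
    nlinarith
  calc ((4 : ℝ) ^ N * 6 ^ (2 * m)) ^ 10 = (4 ^ 10) ^ N * 6 ^ (20 * m) := by
        rw [mul_pow, ← pow_mul, ← pow_mul, ← pow_mul]; congr 2 <;> ring
    _ ≤ (4 ^ 10) ^ N * 6 ^ N := by gcongr; norm_num
    _ = (6 * 4 ^ 10) ^ N := by rw [mul_comm, ← mul_pow]
    _ ≤ (6 ^ 10 * Real.exp (-(1 / 5)) ^ 10) ^ N := by gcongr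
    _ = (6 ^ N * Real.exp (-(1 / 5)) ^ N) ^ 10 := by
        rw [← mul_pow, ← mul_pow, ← pow_mul, ← pow_mul, mul_comm N]

/-- Markov's inequality for the uniform distribution on a finite set. -/
lemma one_sub_le_unifProb {α : Type} (S : Finset α) (hS : S.Nonempty) (D : α → ℝ)
    (hD : ∀ x, 0 < D x) (q : ℝ) (h : unifExp S (fun x => 1 / D x) ≤ Real.exp (-(2 * q))) :
    1 - Real.exp (-q) ≤ unifProb S (fun x => Real.exp q ≤ D x) := by
  classical
  have hS0 : (0 : ℝ) < S.card := by exact_mod_cast hS.card_pos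
  rw [unifExp, div_le_iff₀ hS0] at h
  rw [unifProb, le_div_iff₀ hS0]
  have hsplit := Finset.card_filter_add_card_filter_not (s := S) (fun x => Real.exp q ≤ D x)
  have hsplit' : ((S.filter fun x => Real.exp q ≤ D x).card : ℝ)
      + (S.filter fun x => ¬ Real.exp q ≤ D x).card = S.card := by exact_mod_cast hsplit
  have hbad : ((S.filter fun x => ¬ Real.exp q ≤ D x).card : ℝ) * Real.exp (-q)
      ≤ Real.exp (-(2 * q)) * S.card := by
    refine le_trans ?_ h
    refine le_trans ?_ (Finset.sum_le_sum_of_subset_of_nonneg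
      (Finset.filter_subset (fun x => ¬ Real.exp q ≤ D x) S) fun x _ _ =>
        (one_div_pos.mpr (hD x)).le)
    rw [← nsmul_eq_mul]
    refine Finset.card_nsmul_le_sum _ _ _ fun x hx => ?_
    rw [Real.exp_neg, ← one_div]
    exact one_div_le_one_div_of_le (hD x) (not_le.mp (Finset.mem_filter.mp hx).2).le
  have hbad' : ((S.filter fun x => ¬ Real.exp q ≤ D x).card : ℝ) ≤ Real.exp (-q) * S.card := by
    refine le_of_mul_le_mul_right (hbad.trans (le_of_eq ?_)) (Real.exp_pos (-q))
    rw [show -(2 * q) = -q + -q by ring, Real.exp_add]; ring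
  have : (1 - Real.exp (-q)) * S.card ≤ (S.filter fun x => Real.exp q ≤ D x).card := by linarith
  convert this

end QubitLattice

/-! ### Choice of constants and conclusion. -/

theorem theorem3 (d r : ℕ) (a b : ℝ) (ha : 0 < a) :
    ∃ C > (0 : ℝ), ∃ K > (0 : ℝ), ∃ γ > (0 : ℝ),
      ∀ δ : ℕ → ℝ, δ =o[atTop] (fun n : ℕ => (n : ℝ)) → (∀ᶠ n in atTop, K ≤ δ n) →
        ∃ N₀ : ℕ, ∀ (N : ℕ) (L : Fin d → ℕ), N₀ ≤ N → N = ∏ k, L k → (∀ k, r < L k) →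
          ∀ (bc : Boundary) (c : PauliString (Site L) → ℝ), IsLocalExtensive bc r a b c →
            ∀ e : OrthonormalBasis (Fin (2 ^ N)) ℂ (Hilb (Site L)),
              IsEigenbasis (hamiltonian c) e →
                ∀ β : ℝ, |β| ≤ C →
                  (shell (hamiltonian c) β (δ N)).Nonempty ∧
                  unifExp (shell (hamiltonian c) β (δ N))
                      (fun ψ => 1 / effDim e (productState ψ)) ≤ Real.exp (-(γ * N)) ∧
                  1 - Real.exp (-(γ * N)) ≤
                    unifProb (shell (hamiltonian c) β (δ N))
                      (fun ψ => Real.exp (γ * N) ≤ effDim e (productState ψ)) := by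
  obtain ⟨V, hV⟩ : ∃ V : ℕ, V = (4 * r + 1) ^ d := ⟨_, rfl⟩
  obtain ⟨D, hD⟩ : ∃ D : ℕ, D = 4 ^ V := ⟨_, rfl⟩
  obtain ⟨G, hG⟩ : ∃ G : ℕ, G = (r + 1) ^ d * (r + 1) ^ d := ⟨_, rfl⟩
  obtain ⟨M, hM⟩ : ∃ M : ℕ, M = V * D * (V * D) := ⟨_, rfl⟩
  obtain ⟨B, hB⟩ : ∃ B : ℝ, B = max a b := ⟨_, rfl⟩
  have hV0 : 0 < V := by rw [hV]; positivity
  have hD0 : 0 < D := by rw [hD]; positivity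
  have hG0 : 0 < G := by rw [hG]; positivity
  have hM0 : 0 < M := by rw [hM]; positivity
  have hB0 : 0 < B := by rw [hB]; exact ha.trans_le (le_max_left _ _)
  have hVr : (0 : ℝ) < V := by exact_mod_cast hV0
  have hDr : (0 : ℝ) < D := by exact_mod_cast hD0
  have hGr : (0 : ℝ) < G := by exact_mod_cast hG0
  have hMr : (0 : ℝ) < M := by exact_mod_cast hM0
  -- The density of fixed terms: the first bound ensures that enough conflict-free terms exist, the
  -- second that at most `N / 20` sites are fixed.
  obtain ⟨κ, hκ⟩ : ∃ κ : ℝ, κ = min (1 / ((G : ℝ) * M)) (1 / (20 * (V : ℝ))) := ⟨_, rfl⟩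
  have hκ0 : 0 < κ := by rw [hκ]; positivity
  have hκM : κ * (G * M) ≤ 1 := by
    rw [← le_div_iff₀ (by positivity), hκ]; exact min_le_left _ _
  have hκV : 20 * κ * V ≤ 1 := by
    have : κ * (20 * V) ≤ 1 := by
      rw [← le_div_iff₀ (by positivity), hκ]; exact min_le_right _ _
    linarith
  obtain ⟨s, hs⟩ : ∃ s : ℝ, s = a * (1 / 3) ^ V := ⟨_, rfl⟩
  have hs0 : 0 < s := by rw [hs]; positivity
  -- Chosen so that the thermal energy bound `B * M * t * D * N` equals `κ * s / 8 * N`.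
  obtain ⟨t, ht⟩ : ∃ t : ℝ, t = κ * s / 8 / (B * M * D) := ⟨_, rfl⟩
  have ht0 : 0 < t := by rw [ht]; positivity
  obtain ⟨ρ, hρ⟩ : ∃ ρ : ℝ, ρ = κ * s / (4 * (B * D)) := ⟨_, rfl⟩
  have hρ0 : 0 < ρ := by rw [hρ]; positivity
  refine ⟨t / 2 / (B * M), by positivity, 2 * B * D, by positivity, 1 / 20, by norm_num, ?_⟩
  intro δ _ hδ
  -- Of the decay `exp (-N / 5)`, one half absorbs the polynomial factor `N / ρ ^ 2`. The other half
  -- is the bound on the mean, and Markov's inequality halves its exponent to give `γ = 1 / 20`.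
  have hlim : ∀ᶠ n : ℕ in atTop, (n : ℝ) * Real.exp (-(1 / 10)) ^ n ≤ ρ ^ 2 := by
    have h1 := tendsto_pow_const_mul_const_pow_of_abs_lt_one 1
      (r := Real.exp (-(1 / 10))) (by
        rw [abs_of_pos (Real.exp_pos _)]; exact Real.exp_lt_one_iff.mpr (by norm_num))
    simp only [pow_one] at h1
    exact h1.eventually_le_const (by positivity)
  have hlarge : ∀ᶠ n : ℕ in atTop, 2 / κ ≤ n :=
    tendsto_natCast_atTop_atTop.eventually_ge_atTop _
  obtain ⟨N₀, hN₀⟩ := eventually_atTop.mp (hδ.and (hlim.and hlarge))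
  refine ⟨N₀, fun N L hN hNL hL bc c hc e he β hβ => ?_⟩
  obtain ⟨hδN, hlimN, hlargeN⟩ := hN₀ N hN
  rw [div_le_iff₀ hκ0, mul_comm] at hlargeN
  have hcard : Fintype.card (Site L) = N := by rw [hNL]; simp
  have hsp : IsSparse c V D a B := by rw [hD, hV, hB]; exact hc.isSparse ha
  have hterms : N ≤ G * (terms c).card := by
    rw [hG, mul_assoc, hNL]; exact hc.prod_le_card_terms hL
  have hE : |thermalEnergy (hamiltonian c) β| ≤ κ * s / 8 * N := by
    have h1 := hsp.abs_thermalEnergy_le e he (β := β) (t := t) ht0 (by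
      rw [← hM, ← le_div_iff₀ (by positivity)]; exact hβ)
    rw [← hM, hcard] at h1
    refine h1.trans (le_of_eq ?_)
    rw [ht]; field_simp
  obtain ⟨m, hm, hshell⟩ := hsp.card_shell_ge (G := G) (κ := κ) (β := β) (δ := δ N) ha hB0 hD0
    (by rwa [hcard]) hκ0 (by rwa [← hM]) hκV (by rwa [hcard]) (by rwa [hcard, ← hs]) hδN
  rw [hcard] at hm
  rw [hcard, ← hs, ← hρ] at hshell
  set S := shell (hamiltonian c) β (δ N) with hSdef
  have hS0 : (0 : ℝ) < S.card := by
    have h1 : 0 < ρ ^ 2 * (6 : ℝ) ^ N := by positivity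
    by_contra hc0
    have h2 : (S.card : ℝ) = 0 := le_antisymm (not_lt.mp hc0) (Nat.cast_nonneg _)
    rw [h2, mul_zero, mul_zero] at hshell
    linarith
  have hSne : S.Nonempty := Finset.card_pos.mp (by exact_mod_cast hS0)
  have hexp : unifExp S (fun ψ => 1 / effDim e (productState ψ))
      ≤ Real.exp (-(2 * (1 / 20 * N))) := by
    rw [unifExp, div_le_iff₀ hS0]
    have h4 : ∑ ψ ∈ S, 1 / effDim e (productState ψ) ≤ 4 ^ N := by
      refine le_trans ?_ (le_of_eq (congrArg (fun n => (4 : ℝ) ^ n) hcard))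
      exact (Finset.sum_le_sum_of_subset_of_nonneg (Finset.subset_univ S) fun ψ _ _ =>
        (one_div_pos.mpr (effDim_pos e ψ)).le).trans (sum_one_div_effDim_le e)
    refine h4.trans ?_
    have h5 : Real.exp (-(2 * (1 / 20 * N))) = Real.exp (-(1 / 10)) ^ N := by
      rw [← Real.exp_nat_mul]; congr 1; ring
    have h6 : Real.exp (-(1 / 5)) ^ N = Real.exp (-(1 / 10)) ^ N * Real.exp (-(1 / 10)) ^ N := by
      rw [← mul_pow, ← Real.exp_add]; norm_num
    have h7 := four_pow_mul_six_pow_le hm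
    rw [h5]
    rw [h6] at h7
    set x : ℝ := Real.exp (-(1 / 10)) ^ N with hx
    have hx0 : 0 < x := by positivity
    have hprod : ρ ^ 2 * 6 ^ N * 4 ^ N ≤ ρ ^ 2 * 6 ^ N * (x * S.card) := by
      calc ρ ^ 2 * 6 ^ N * 4 ^ N ≤ 6 ^ (2 * m) * (N * S.card) * 4 ^ N :=
            mul_le_mul_of_nonneg_right hshell (by positivity)
        _ = (4 ^ N * 6 ^ (2 * m)) * (N * S.card) := by ring
        _ ≤ (6 ^ N * (x * x)) * (N * S.card) :=
            mul_le_mul_of_nonneg_right h7 (by positivity)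
        _ = (N * x) * (6 ^ N * (x * S.card)) := by ring
        _ ≤ ρ ^ 2 * (6 ^ N * (x * S.card)) :=
            mul_le_mul_of_nonneg_right hlimN (by positivity)
        _ = ρ ^ 2 * 6 ^ N * (x * S.card) := by ring
    exact le_of_mul_le_mul_left hprod (by positivity)
  refine ⟨hSne, hexp.trans (Real.exp_le_exp.mpr ?_), ?_⟩
  · have : (0 : ℝ) ≤ N := Nat.cast_nonneg _
    linarith
  · exact one_sub_le_unifProb S hSne (fun ψ => effDim e (productState ψ)) (effDim_pos e) _ hexp
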